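/- Fix $d\ge 0$, let $\langle\cdot,\cdot\rangle$ be the inner product of $L^2(\mathbb{R}^d)$, antilinear in the second argument, and write $z=(x,\omega)\in\mathbb{R}^{2d}$. Put $(\pi(z)\varphi)(t)=e^{2\pi i\omega\cdot t}\varphi(t-x)$, and let $$V_\varphi\psi(z)=\langle\psi,\pi(z)\varphi\rangle,\qquad A(\psi,\varphi)(z)=e^{\pi i x\cdot\omega}V_\varphi\psi(z),$$ $$W(\psi,\varphi)(z)=\int_{\mathbb{R}^d}\psi(x+\tfrac t2)\overline{\varphi(x-\tfrac t2)}e^{-2\pi i\omega\cdot t}\,dt$$ be the short-time Fourier transform, the cross-ambiguity function and the cross-Wigner distribution of $\psi,\varphi\in L^2(\mathbb{R}^d)$. For $\phi\in L^2(\mathbb{R}^{2d})$ let $Q_\phi(\psi)=W(\psi,\psi)*\phi$ be the associated Cohen's class distribution, let the Weyl transform $L_\phi$ be the bounded operator on $L^2(\mathbb{R}^d)$ with $\langle L_\phi\psi,\chi\rangle=\int_{\mathbb{R}^{2d}}\phi(z)\,W(\psi,\chi)(z)\,dz$ for all Schwartz functions $\psi,\chi$, and let $\mathcal{F}_\sigma$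 be the unitary extension to $L^2(\mathbb{R}^{2d})$ of the symplectic Fourier transform $\mathcal{F}_\sigma f(z)=\int f(z')e^{-2\pi i\sigma(z,z')}\,dz'$, where $\sigma((x_1,\omega_1),(x_2,\omega_2))=\omega_1\cdot x_2-\omega_2\cdot x_1$. An operator is trace class if it is compact with summable singular values. (1) Let $\phi\in L^2(\mathbb{R}^{2d})$ be such that $L_\phi$ is trace class. Then $\mathcal{F}_\sigma\phi$ has a (necessarily unique) continuous representative. Suppose that the zero set $\{z\in\mathbb{R}^{2d}:\mathcal{F}_\sigma\phi(z)=0\}$ of this representative has dense complement in $\mathbb{R}^{2d}$. If $\psi_1,\psi_2\in L^2(\mathbb{R}^d)$ satisfy $Q_\phi(\psi_1)=Q_\phi(\psi_2)$ (almost everywhere), then $\psi_1=e^{i\alpha}\psi_2$ for some constant $\alpha\in\mathbb{R}$. (2) Let $\varphi\in L^2(\mathbb{R}^d)$ be such that $\{z\in\mathbb{R}^{2d}:A(\varphi,\varphi)(z)=0\}$ has dense complement in $\mathbb{R}^{2d}$. If $\psi_1,\psi_2\in L^2(\mathbb{R}^d)$ satisfy $|V_\varphi\psi_1(z)|=|V_\varphi\psi_2(z)|$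 for all $z\in\mathbb{R}^{2d}$, then $\psi_1=e^{i\alpha}\psi_2$ for some constant $\alpha\in\mathbb{R}$. -/

import Mathlib

open MeasureTheory SchwartzMap FourierTransform Convolution

noncomputable section

/-- Configuration space `ℝᵈ` with its Euclidean structure and Lebesgue measure. -/
abbrev Config (d : ℕ) : Type := EuclideanSpace ℝ (Fin d)

/-- Phase space `ℝ²ᵈ = ℝᵈ × ℝᵈ`, whose points are `z = (x, ω)` with `x = z.fst`, `ω = z.snd`; the
Euclidean product structure is used, so that `volume` is Lebesgue measure on `ℝ²ᵈ`. -/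
abbrev PhaseSpace (d : ℕ) : Type := WithLp 2 (Config d × Config d)

/-- The complex Hilbert space `L²(ℝᵈ)`. -/
abbrev L2Config (d : ℕ) : Type := Lp ℂ 2 (volume : Measure (Config d))

/-- The complex Hilbert space `L²(ℝ²ᵈ)`. -/
abbrev L2Phase (d : ℕ) : Type := Lp ℂ 2 (volume : Measure (PhaseSpace d))

/-- The standard symplectic form `σ((x₁, ω₁), (x₂, ω₂)) = ω₁ · x₂ - ω₂ · x₁`. -/
def symplecticForm {d : ℕ} (z z' : PhaseSpace d) : ℝ :=
  inner ℝ z.snd z'.fst - inner ℝ z'.snd z.fst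

/-- The symplectic Fourier transform of a function on phase space, given by the integral
`∫ f(z') e^{-2πi σ(z, z')} dz'`. -/
def symplecticFourierIntegral {d : ℕ} (f : PhaseSpace d → ℂ) (z : PhaseSpace d) : ℂ :=
  ∫ z' : PhaseSpace d, f z' * Complex.exp (-(2 * Real.pi * symplecticForm z z' : ℝ) * Complex.I)

/-- The linear isometry `J (x, ω) = (ω, -x)` of phase space; it satisfies `⟪z', J z⟫ = σ(z, z')`. -/
def symplecticJ (d : ℕ) : PhaseSpace d ≃ₗᵢ[ℝ] PhaseSpace d where
  toFun z := WithLp.toLp 2 (z.snd, -z.fst)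
  invFun z := WithLp.toLp 2 (-z.snd, z.fst)
  left_inv z := WithLp.ofLp_injective 2 (by ext <;> simp)
  right_inv z := WithLp.ofLp_injective 2 (by ext <;> simp)
  map_add' z w := WithLp.ofLp_injective 2 (by simp [add_comm])
  map_smul' c z := WithLp.ofLp_injective 2 (by simp)
  norm_map' z := by
    simp [WithLp.prod_norm_eq_of_L2, add_comm]

theorem inner_symplecticJ {d : ℕ} (z z' : PhaseSpace d) :
    inner ℝ z' (symplecticJ d z) = symplecticForm z z' := by
  simp [symplecticJ, symplecticForm, WithLp.prod_inner_apply, real_inner_comm, sub_eq_add_neg]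

/-- The symplectic Fourier transform `F_σ` on `L²(ℝ²ᵈ)`: since `σ(z, z') = ⟪z', J z⟫`, it is the
`L²` Fourier transform followed by composition with the isometry `J`. -/
def symplecticFourier {d : ℕ} (f : L2Phase d) : L2Phase d :=
  Lp.compMeasurePreserving (symplecticJ d) (symplecticJ d).measurePreserving (𝓕 f)

/-- `F_σ` is isometric on `L²(ℝ²ᵈ)`. -/
theorem norm_symplecticFourier {d : ℕ} (f : L2Phase d) : ‖symplecticFourier f‖ = ‖f‖ := by
  rw [symplecticFourier, Lp.norm_compMeasurePreserving, Lp.norm_fourier_eq]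

/-- On the dense subspace of Schwartz functions, `F_σ` is given by the integral formula. -/
theorem symplecticFourier_toLp {d : ℕ} (f : 𝓢(PhaseSpace d, ℂ)) :
    symplecticFourier (f.toLp 2) =ᵐ[volume] symplecticFourierIntegral f := by
  have h1 := Lp.coeFn_compMeasurePreserving (𝓕 (f.toLp 2 (volume : Measure (PhaseSpace d))))
    (symplecticJ d).measurePreserving
  have h2 : (𝓕 (f.toLp 2 (volume : Measure (PhaseSpace d))) : L2Phase d)
      =ᵐ[volume] (𝓕 f : 𝓢(PhaseSpace d, ℂ)) := by
    rw [SchwartzMap.toLp_fourier_eq]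
    exact SchwartzMap.coeFn_toLp _ _ _
  have h3 := (symplecticJ d).measurePreserving.quasiMeasurePreserving.ae_eq_comp h2
  refine h1.trans (h3.trans (Filter.Eventually.of_forall fun z => ?_))
  simp only [Function.comp, SchwartzMap.fourier_coe, symplecticFourierIntegral]
  rw [Real.fourier_eq']
  refine integral_congr_ae (Filter.Eventually.of_forall fun z' => ?_)
  simp only [inner_symplecticJ, smul_eq_mul]
  rw [mul_comm]
  congr 2
  push_cast
  ring

/-- The time-frequency shift `π(z) = M_ω T_x`: `(π(z) f)(t) = e^{2πi ω·t} f(t - x)`. -/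
def timeFreqShift {d : ℕ} (z : PhaseSpace d) (f : Config d → ℂ) (t : Config d) : ℂ :=
  Complex.exp ((2 * Real.pi * inner ℝ z.snd t : ℝ) * Complex.I) * f (t - z.fst)

/-- The short-time Fourier transform `V_φ ψ (z) = ⟨ψ, π(z) φ⟩` with window `φ`, where the inner
product is antilinear in its second argument. -/
def stft {d : ℕ} (φ ψ : Config d → ℂ) (z : PhaseSpace d) : ℂ :=
  ∫ t : Config d, ψ t * starRingEnd ℂ (timeFreqShift z φ t)

/-- The cross-ambiguity function `A(ψ, φ)(z) = e^{πi x·ω} V_φ ψ (z)`. -/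
def ambiguity {d : ℕ} (ψ φ : Config d → ℂ) (z : PhaseSpace d) : ℂ :=
  Complex.exp ((Real.pi * inner ℝ z.fst z.snd : ℝ) * Complex.I) * stft φ ψ z

/-- The cross-Wigner distribution
`W(ψ, φ)(x, ω) = ∫ ψ(x + t/2) conj(φ(x - t/2)) e^{-2πi ω·t} dt`. -/
def wigner {d : ℕ} (ψ φ : Config d → ℂ) (z : PhaseSpace d) : ℂ :=
  ∫ t : Config d, ψ (z.fst + (2⁻¹ : ℝ) • t) * starRingEnd ℂ (φ (z.fst - (2⁻¹ : ℝ) • t)) *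
    Complex.exp (-(2 * Real.pi * inner ℝ z.snd t : ℝ) * Complex.I)

/-- The bounded operator `L` on `L²(ℝᵈ)` is the Weyl transform `L_f` of the function `f`:
`⟨L ψ, χ⟩ = ∫ f(z) W(ψ, χ)(z) dz` for all Schwartz functions `ψ, χ`. Mathlib's inner product is
antilinear in its first argument, so `⟨L ψ, χ⟩` in the usual notation is `inner ℂ χ (L ψ)`. -/
def IsWeylTransform {d : ℕ} (f : PhaseSpace d → ℂ) (L : L2Config d →L[ℂ] L2Config d) : Prop :=
  ∀ ψ χ : 𝓢(Config d, ℂ),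
    inner ℂ (χ.toLp 2 volume : L2Config d) (L (ψ.toLp 2 volume)) =
      ∫ z : PhaseSpace d, f z * wigner ψ χ z

/-- Trace class operators on a Hilbert space: those with a singular value decomposition
`S = ∑ sₙ uₙ ⊗ vₙ` (convergent in operator norm), where `(uₙ)` and `(vₙ)` are orthonormal,
the singular values `sₙ` are positive, and `∑ sₙ < ∞`. Here `(u ⊗ v) ξ = ⟨ξ, v⟩ u`. The index type
is arbitrary so as to cover finite rank; it is automatically countable. -/
def IsTraceClass {H : Type*} [NormedAddCommGroup H] [InnerProductSpace ℂ H]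
    (S : H →L[ℂ] H) : Prop :=
  ∃ (ι : Type) (s : ι → ℝ) (u v : ι → H),
    Orthonormal ℂ u ∧ Orthonormal ℂ v ∧ (∀ n, 0 < s n) ∧ Summable s ∧
      HasSum (fun n => (s n : ℂ) • InnerProductSpace.rankOne ℂ (u n) (v n)) S

/-- The Cohen's class distribution `Q_φ(ψ) = W(ψ, ψ) ∗ φ`. -/
def cohen {d : ℕ} (φ : PhaseSpace d → ℂ) (ψ : Config d → ℂ) : PhaseSpace d → ℂ :=
  wigner ψ ψ ⋆[ContinuousLinearMap.mul ℂ ℂ, volume] φ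

end

/-!
Both parts rest on the operators `ρ(z) = e^{-πi x·ω} π(z)` on `L²(ℝᵈ)` (`symmShift`), which satisfy
`ρ(z) ρ(w) = e^{πi σ(z, w)} ρ(z + w)`. Ambiguity functions and Wigner distributions are their matrix
coefficients: with `P` the parity operator, `A(ψ, χ)(z) = ⟨ψ, ρ(z) χ⟩` and
`W(ψ, χ)(z) = 2ᵈ ⟨ψ, ρ(2z) P χ⟩` (`amb`, `wig`). Plancherel's theorem in the frequency variable
gives Moyal's identity `⟨A(ψ, χ), A(ψ', χ')⟩ = ⟨ψ, ψ'⟩ ⟨χ', χ⟩` (`inner_ambL2`), and the same for `W` by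
scaling. In particular `A(ψ, ψ)` determines the rank-one operator `ψ ⊗ ψ`, hence `ψ` up to a phase
(`exists_phase_of_amb_self_eq`), so it is enough to show `A(ψ₁, ψ₁) = A(ψ₂, ψ₂)`. Since ambiguity
functions are continuous, it is enough to do so after multiplication by a continuous function whose
zero set has dense complement.

For the spectrogram, covariance and Moyal's identity show that the symplectic Fourier transform of
`|V_φ ψ|²` is `A(ψ, ψ)` times the conjugate of `A(φ, φ)`
(`integral_norm_sq_amb_mul_cexp`), and the latter serves as the multiplier.

For Cohen's class the multiplier is `F_σ φ`. The identity `F_σ W(ψ, χ) = A(ψ, χ)`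
(`symplecticFourier_wigL2`) is an explicit computation when `ψ = χ` is a Gaussian. By covariance it
then holds for time-frequency shifts of the Gaussian, which are total by Moyal's identity, and it
extends to `L²` by density. Since `F_σ` is unitary, it follows that `W(ψ, ψ) ∗ φ` is
the symplectic Fourier transform of the integrable function `A(ψ, ψ) · F_σ φ`
(`cohen_eq_symplecticFourierIntegral`), which is therefore determined by `Q_φ(ψ)`. Finally, if
`L_φ = ∑ sₙ uₙ ⊗ vₙ` is trace class, Moyal's identity and totality of the Wigner distributions
(`eq_zero_of_inner_wigL2_eq_zero`) give `φ = ∑ sₙ W(uₙ, vₙ)`, so that `F_σ φ` is represented by the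
uniformly convergent series `∑ sₙ A(uₙ, vₙ)` of continuous functions
(`exists_continuous_symplecticFourier`).
-/

/-! ### The Fourier transform on `L¹ ∩ L²` -/

section FourierL1L2

variable {E : Type*} [NormedAddCommGroup E] [InnerProductSpace ℝ E] [FiniteDimensional ℝ E]
  [MeasurableSpace E] [BorelSpace E]

theorem continuous_fourier_of_integrable {f : E → ℂ} (hf : Integrable f) :
    Continuous (𝓕 f : E → ℂ) :=
  VectorFourier.fourierIntegral_continuous Real.continuous_fourierChar
    (by exact continuous_inner) hf

/-- Both transforms have the same pairings with test functions. -/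
theorem fourier_Lp_ae_eq_fourier_integral (f : Lp ℂ 2 (volume : Measure E)) (hf : Integrable f) :
    (𝓕 f : Lp ℂ 2 (volume : Measure E)) =ᵐ[volume] (𝓕 (f : E → ℂ) : E → ℂ) := by
  set F : Lp ℂ 2 (volume : Measure E) := 𝓕 f with hF
  have hloc1 : LocallyIntegrable F (volume : Measure E) :=
    (Lp.memLp F).locallyIntegrable (by norm_num)
  have hloc2 : LocallyIntegrable (𝓕 (f : E → ℂ) : E → ℂ) (volume : Measure E) :=
    (continuous_fourier_of_integrable hf).locallyIntegrable
  refine ae_eq_of_integral_contDiff_smul_eq hloc1 hloc2 fun g hg hgc => ?_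
  have hg₁ : HasCompactSupport (Complex.ofRealCLM ∘ g) := hgc.comp_left rfl
  have hg₂ : ContDiff ℝ (⊤ : ℕ∞) (Complex.ofRealCLM ∘ g) := by fun_prop
  let G : 𝓢(E, ℂ) := hg₁.toSchwartzMap hg₂
  have h1 := congrArg (fun T : 𝓢'(E, ℂ) => T G) (Lp.fourier_toTemperedDistribution_eq f)
  simp only [TemperedDistribution.fourier_apply, Lp.toTemperedDistribution_apply] at h1
  have h2 : ∫ ξ, (𝓕 (G : E → ℂ) ξ) • f ξ = ∫ x, G x • (𝓕 (f : E → ℂ) x) := by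
    have := VectorFourier.integral_fourierIntegral_smul_eq_flip (μ := volume) (ν := volume)
      (L := innerₗ E) Real.continuous_fourierChar (by exact continuous_inner) G.integrable hf
    rw [flip_innerₗ] at this
    exact this
  rw [SchwartzMap.fourier_coe] at h1
  rw [← hF] at h1
  calc ∫ x, g x • F x = ∫ x, G x • F x := by
        simp [G]
    _ = ∫ x, G x • (𝓕 (f : E → ℂ) x) := by rw [← h1, ← h2]
    _ = ∫ x, g x • (𝓕 (f : E → ℂ) x) := by simp [G]

theorem eLpNorm_fourier_of_integrable {f : E → ℂ} (hf : Integrable f) (hf2 : MemLp f 2) :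
    eLpNorm (𝓕 f : E → ℂ) 2 volume = eLpNorm f 2 volume := by
  have hc : (hf2.toLp f : E → ℂ) =ᵐ[volume] f := hf2.coeFn_toLp
  have h := fourier_Lp_ae_eq_fourier_integral (hf2.toLp f) (hf.congr hc.symm)
  have h3 : 𝓕 (hf2.toLp f : E → ℂ) = (𝓕 f : E → ℂ) := by
    ext x; exact Real.fourier_congr_ae hc x
  rw [h3] at h
  rw [← eLpNorm_congr_ae h, ← eLpNorm_congr_ae hc]
  have := Lp.norm_fourier_eq (hf2.toLp f)
  rw [Lp.norm_def, Lp.norm_def] at this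
  exact (ENNReal.toReal_eq_toReal_iff' (Lp.eLpNorm_ne_top _) (Lp.eLpNorm_ne_top _)).1 this

/-- The Fourier transform is injective on `L¹ ∩ L²`. -/
theorem ae_eq_zero_of_fourier_ae_eq_zero {f : E → ℂ} (hf : Integrable f) (hf2 : MemLp f 2)
    (h : (𝓕 f : E → ℂ) =ᵐ[volume] 0) : f =ᵐ[volume] 0 := by
  have h1 := eLpNorm_fourier_of_integrable hf hf2
  rw [eLpNorm_congr_ae h, eLpNorm_zero] at h1
  exact (eLpNorm_eq_zero_iff hf2.1 (by norm_num)).1 h1.symm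

end FourierL1L2

/-! ### Sesquilinear forms and scalar phases -/

section Sesquilinear

variable {H : Type*} [NormedAddCommGroup H] [InnerProductSpace ℂ H]

/-- Polarization: a sesquilinear form which vanishes on the diagonal is zero. -/
theorem eq_zero_of_diag_eq_zero {V : Type*} [AddCommGroup V] [Module ℂ V] (S : V → V → ℂ)
    (add_left : ∀ x y z, S (x + y) z = S x z + S y z)
    (add_right : ∀ x y z, S x (y + z) = S x y + S x z)
    (smul_left : ∀ (c : ℂ) x y, S (c • x) y = starRingEnd ℂ c * S x y)
    (smul_right : ∀ (c : ℂ) x y, S x (c • y) = c * S x y)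
    (diag : ∀ x, S x x = 0) (x y : V) : S x y = 0 := by
  have h1 : ∀ u v, S u v + S v u = 0 := fun u v => by
    have := diag (u + v)
    rw [add_left, add_right, add_right, diag, diag] at this
    simpa using this
  have h2 := h1 x (Complex.I • y)
  rw [smul_left, smul_right, Complex.conj_I] at h2
  have h3 : Complex.I * (S x y - S y x) = 0 := by linear_combination h2
  have h4 : S x y - S y x = 0 := by
    simpa [Complex.I_ne_zero] using h3
  linear_combination (h4 + h1 x y) / 2

/-- If the rank-one operators `x ⊗ x` and `y ⊗ y` agree, then `x` and `y` agree up to a phase. -/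
theorem exists_phase_of_inner_mul_inner_eq (x y : H)
    (h : ∀ u v : H, inner ℂ u x * inner ℂ x v = inner ℂ u y * inner ℂ y v) :
    ∃ α : ℝ, x = Complex.exp (Complex.I * α) • y := by
  by_cases hy : y = 0
  · subst hy
    have := h x x
    simp at this
    exact ⟨0, by simp [this]⟩
  have hyy : (inner ℂ y y : ℂ) ≠ 0 := by simpa using hy
  -- `c` is the coefficient of the projection of `x` onto `y`
  set c : ℂ := inner ℂ y x / inner ℂ y y with hc
  have hcc : c * starRingEnd ℂ c = 1 := by
    have h0 := h y y
    have e1 : starRingEnd ℂ (inner ℂ y x) = inner ℂ x y := inner_conj_symm _ _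
    have e2 : starRingEnd ℂ (inner ℂ y y) = (inner ℂ y y : ℂ) := inner_conj_symm _ _
    rw [hc, map_div₀, e1, e2]
    field_simp
    linear_combination h0
  have hxy : x = c • y := by
    have hxyne : (inner ℂ x y : ℂ) ≠ 0 := by
      intro h0
      rw [hc, map_div₀, inner_conj_symm, h0] at hcc
      simp at hcc
    refine ext_inner_left ℂ fun u => ?_
    have h0 := h u y
    have h1 := h y y
    rw [inner_smul_right, hc]
    rw [div_mul_eq_mul_div, eq_div_iff hyy]
    refine mul_right_cancel₀ hxyne ?_
    linear_combination inner ℂ y y * h0 - inner ℂ u y * h1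
  have hn : ‖c‖ = 1 := by
    have h2 : ‖c‖ * ‖c‖ = 1 := by
      have := congrArg norm hcc
      simpa using this
    nlinarith [norm_nonneg c]
  refine ⟨c.arg, ?_⟩
  have := Complex.norm_mul_exp_arg_mul_I c
  rw [hn, Complex.ofReal_one, one_mul, mul_comm] at this
  rw [this]
  exact hxy

end Sesquilinear

/-! ### Symmetric time-frequency shifts and the parity operator on `L²(ℝᵈ)` -/

section Heisenberg

variable {d : ℕ}

theorem norm_cexp_ofReal_mul_I (r : ℝ) : ‖Complex.exp ((r : ℂ) * Complex.I)‖ = 1 :=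
  Complex.norm_exp_ofReal_mul_I r

theorem conj_cexp_ofReal_mul_I (r : ℝ) :
    starRingEnd ℂ (Complex.exp ((r : ℂ) * Complex.I)) =
      Complex.exp (((-r : ℝ) : ℂ) * Complex.I) := by
  rw [← Complex.exp_conj]
  simp

/-- The symmetric time-frequency shift `ρ(z) = e^{-πi x·ω} π(z)` of a function on `ℝᵈ`. -/
noncomputable def symmShiftFun (z : PhaseSpace d) (f : Config d → ℂ) (t : Config d) : ℂ :=
  Complex.exp ((2 * Real.pi * inner ℝ z.snd t - Real.pi * inner ℝ z.fst z.snd : ℝ) * Complex.I) *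
    f (t - z.fst)

theorem norm_symmShiftFun (z : PhaseSpace d) (f : Config d → ℂ) (t : Config d) :
    ‖symmShiftFun z f t‖ = ‖f (t - z.fst)‖ := by
  rw [symmShiftFun, norm_mul, norm_cexp_ofReal_mul_I, one_mul]

theorem symmShiftFun_congr_ae (z : PhaseSpace d) {f g : Config d → ℂ} (h : f =ᵐ[volume] g) :
    symmShiftFun z f =ᵐ[volume] symmShiftFun z g := by
  have := (measurePreserving_sub_right (volume : Measure (Config d))
    z.fst).quasiMeasurePreserving.ae_eq_comp h
  filter_upwards [this] with t ht
  simp only [Function.comp] at ht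
  simp [symmShiftFun, ht]

theorem memLp_symmShiftFun (z : PhaseSpace d) {f : Config d → ℂ} (hf : MemLp f 2) :
    MemLp (symmShiftFun z f) 2 := by
  have h1 := hf.comp_measurePreserving
    (measurePreserving_sub_right (volume : Measure (Config d)) z.fst)
  refine h1.congr_norm ?_ (Filter.Eventually.of_forall fun t => (norm_symmShiftFun z f t).symm)
  refine AEStronglyMeasurable.mul ?_ h1.1
  exact (by fun_prop : Continuous _).aestronglyMeasurable

theorem eLpNorm_symmShiftFun (z : PhaseSpace d) {f : Config d → ℂ} (hf : MemLp f 2) :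
    eLpNorm (symmShiftFun z f) 2 volume = eLpNorm f 2 volume := by
  rw [← eLpNorm_comp_measurePreserving hf.1
    (measurePreserving_sub_right (volume : Measure (Config d)) z.fst)]
  exact eLpNorm_congr_norm_ae (Filter.Eventually.of_forall fun t => norm_symmShiftFun z f t)

/-- The symmetric time-frequency shift `ρ(z)` as an isometry of `L²(ℝᵈ)`. -/
noncomputable def symmShift (z : PhaseSpace d) : L2Config d →ₗᵢ[ℂ] L2Config d where
  toFun ψ := (memLp_symmShiftFun z (Lp.memLp ψ)).toLp _
  map_add' ψ χ := by
    rw [← MemLp.toLp_add]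
    refine MemLp.toLp_congr _ _ ((symmShiftFun_congr_ae z (Lp.coeFn_add ψ χ)).trans ?_)
    exact Filter.Eventually.of_forall fun t => by simp [symmShiftFun, mul_add]
  map_smul' c ψ := by
    rw [RingHom.id_apply, ← MemLp.toLp_const_smul]
    refine MemLp.toLp_congr _ _ ((symmShiftFun_congr_ae z (Lp.coeFn_smul c ψ)).trans ?_)
    exact Filter.Eventually.of_forall fun t => by simp [symmShiftFun]; ring
  norm_map' ψ := by
    change ‖(memLp_symmShiftFun z (Lp.memLp ψ)).toLp _‖ = ‖ψ‖
    rw [Lp.norm_toLp, eLpNorm_symmShiftFun z (Lp.memLp ψ), Lp.norm_def]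

theorem coeFn_symmShift (z : PhaseSpace d) (ψ : L2Config d) :
    symmShift z ψ =ᵐ[volume] symmShiftFun z ψ :=
  (memLp_symmShiftFun z (Lp.memLp ψ)).coeFn_toLp

/-- The operators `ρ(z)` form a projective representation of phase space with cocycle `σ`. -/
theorem symmShift_symmShift (z w : PhaseSpace d) (ψ : L2Config d) :
    symmShift z (symmShift w ψ) =
      Complex.exp ((Real.pi * symplecticForm z w : ℝ) * Complex.I) • symmShift (z + w) ψ := by
  refine Lp.ext ?_
  filter_upwards [coeFn_symmShift z (symmShift w ψ),
    symmShiftFun_congr_ae z (coeFn_symmShift w ψ), coeFn_symmShift (z + w) ψ,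
    Lp.coeFn_smul (Complex.exp ((Real.pi * symplecticForm z w : ℝ) * Complex.I))
      (symmShift (z + w) ψ)] with t h1 h2 h3 h4
  rw [h1, h2, h4, Pi.smul_apply, h3, smul_eq_mul]
  simp only [symmShiftFun]
  rw [← mul_assoc, ← mul_assoc, ← Complex.exp_add, ← Complex.exp_add, ← add_mul, ← add_mul]
  congr 1
  · congr 2
    norm_cast
    simp only [symplecticForm, WithLp.add_fst, WithLp.add_snd, inner_add_left, inner_add_right,
      inner_sub_right]
    rw [real_inner_comm z.fst w.snd, real_inner_comm z.snd w.fst]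
    ring
  · simp [sub_sub]

@[simp]
theorem symmShift_zero (ψ : L2Config d) : symmShift 0 ψ = ψ := by
  refine Lp.ext ?_
  filter_upwards [coeFn_symmShift 0 ψ] with t h1
  simp [h1, symmShiftFun]

theorem symplecticForm_self (z : PhaseSpace d) : symplecticForm z z = 0 := by
  simp [symplecticForm]

theorem symplecticForm_swap (z w : PhaseSpace d) : symplecticForm z w = -symplecticForm w z := by
  simp [symplecticForm]

theorem symplecticForm_add_left (z z' w : PhaseSpace d) :
    symplecticForm (z + z') w = symplecticForm z w + symplecticForm z' w := by
  simp [symplecticForm, inner_add_left, inner_add_right]; ring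

theorem symplecticForm_smul_left (c : ℝ) (z w : PhaseSpace d) :
    symplecticForm (c • z) w = c * symplecticForm z w := by
  simp [symplecticForm, inner_smul_left, inner_smul_right]; ring

theorem symplecticForm_neg_left (z w : PhaseSpace d) :
    symplecticForm (-z) w = -symplecticForm z w := by
  simp [symplecticForm]; ring

theorem symplecticForm_sub_left (z z' w : PhaseSpace d) :
    symplecticForm (z - z') w = symplecticForm z w - symplecticForm z' w := by
  rw [sub_eq_add_neg, symplecticForm_add_left, symplecticForm_neg_left, sub_eq_add_neg]

theorem symplecticForm_add_right (z w w' : PhaseSpace d) :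
    symplecticForm z (w + w') = symplecticForm z w + symplecticForm z w' := by
  simp [symplecticForm, inner_add_left, inner_add_right]; ring

theorem symplecticForm_smul_right (c : ℝ) (z w : PhaseSpace d) :
    symplecticForm z (c • w) = c * symplecticForm z w := by
  simp [symplecticForm, inner_smul_left, inner_smul_right]; ring

theorem symplecticForm_neg_right (z w : PhaseSpace d) :
    symplecticForm z (-w) = -symplecticForm z w := by
  simp [symplecticForm]; ring

theorem symplecticForm_sub_right (z w w' : PhaseSpace d) :
    symplecticForm z (w - w') = symplecticForm z w - symplecticForm z w' := by
  rw [sub_eq_add_neg, symplecticForm_add_right, symplecticForm_neg_right, sub_eq_add_neg]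

theorem symmShift_neg_symmShift (z : PhaseSpace d) (ψ : L2Config d) :
    symmShift (-z) (symmShift z ψ) = ψ := by
  rw [symmShift_symmShift, symplecticForm_neg_left, symplecticForm_self]
  simp

theorem inner_symmShift_left (z : PhaseSpace d) (ψ χ : L2Config d) :
    inner ℂ (symmShift z ψ) χ = inner ℂ ψ (symmShift (-z) χ) := by
  rw [← (symmShift (-z)).inner_map_map, symmShift_neg_symmShift]

/-- The parity operator `(P ψ)(t) = ψ(-t)` on `L²(ℝᵈ)`. -/
noncomputable def parity (d : ℕ) : L2Config d →ₗᵢ[ℂ] L2Config d :=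
  Lp.compMeasurePreservingₗᵢ ℂ (fun t : Config d => -t) (Measure.measurePreserving_neg volume)

theorem coeFn_parity (ψ : L2Config d) : parity d ψ =ᵐ[volume] fun t => ψ (-t) :=
  Lp.coeFn_compMeasurePreserving ψ (Measure.measurePreserving_neg volume)

@[simp]
theorem parity_parity (ψ : L2Config d) : parity d (parity d ψ) = ψ := by
  refine Lp.ext ?_
  filter_upwards [coeFn_parity (parity d ψ), (Measure.measurePreserving_neg
    (volume : Measure (Config d))).quasiMeasurePreserving.ae_eq_comp (coeFn_parity ψ)] with t h1 h2
  simp only [Function.comp] at h2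
  rw [h1, h2, neg_neg]

theorem inner_parity_left (ψ χ : L2Config d) :
    inner ℂ (parity d ψ) χ = inner ℂ ψ (parity d χ) := by
  rw [← (parity d).inner_map_map, parity_parity]

theorem parity_symmShift (z : PhaseSpace d) (ψ : L2Config d) :
    parity d (symmShift z ψ) = symmShift (-z) (parity d ψ) := by
  refine Lp.ext ?_
  filter_upwards [coeFn_parity (symmShift z ψ), (Measure.measurePreserving_neg
    (volume : Measure (Config d))).quasiMeasurePreserving.ae_eq_comp (coeFn_symmShift z ψ),
    coeFn_symmShift (-z) (parity d ψ), symmShiftFun_congr_ae (-z) (coeFn_parity ψ)]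
    with t h1 h2 h3 h4
  simp only [Function.comp] at h2
  rw [h1, h2, h3, h4]
  simp [symmShiftFun, sub_eq_add_neg, add_comm]

/-! ### Ambiguity function and Wigner distribution as matrix coefficients -/

/-- The cross-ambiguity function of two elements of `L²(ℝᵈ)` as the matrix coefficient
`A(ψ, χ)(z) = ⟨ψ, ρ(z) χ⟩`. -/
noncomputable def amb (ψ χ : L2Config d) (z : PhaseSpace d) : ℂ := inner ℂ (symmShift z χ) ψ

/-- The cross-Wigner distribution of two elements of `L²(ℝᵈ)` as the matrix coefficient
`W(ψ, χ)(z) = 2ᵈ ⟨ψ, ρ(2z) P χ⟩`. -/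
noncomputable def wig (ψ χ : L2Config d) (z : PhaseSpace d) : ℂ :=
  (2 : ℂ) ^ d * amb ψ (parity d χ) ((2 : ℝ) • z)

theorem amb_eq_integral (ψ χ : L2Config d) (z : PhaseSpace d) :
    amb ψ χ z = ∫ t, ψ t * starRingEnd ℂ (symmShiftFun z χ t) := by
  rw [amb, L2.inner_def]
  refine integral_congr_ae ?_
  filter_upwards [coeFn_symmShift z χ] with t h
  rw [h, RCLike.inner_apply]

theorem symmShiftFun_eq (z : PhaseSpace d) (f : Config d → ℂ) (t : Config d) :
    symmShiftFun z f t = Complex.exp (((-(Real.pi * inner ℝ z.fst z.snd) : ℝ) : ℂ) * Complex.I) *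
      timeFreqShift z f t := by
  rw [symmShiftFun, timeFreqShift, ← mul_assoc, ← Complex.exp_add, ← add_mul]
  congr 3
  norm_cast
  ring

theorem amb_eq_ambiguity (ψ χ : L2Config d) : amb ψ χ = ambiguity ψ χ := by
  ext z
  rw [amb_eq_integral, ambiguity, stft, ← integral_const_mul]
  refine integral_congr_ae (Filter.Eventually.of_forall fun t => ?_)
  simp only [symmShiftFun_eq, map_mul, conj_cexp_ofReal_mul_I, neg_neg]
  ring

theorem norm_stft (χ ψ : L2Config d) (z : PhaseSpace d) : ‖stft χ ψ z‖ = ‖amb ψ χ z‖ := by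
  rw [amb_eq_ambiguity, ambiguity, norm_mul, norm_cexp_ofReal_mul_I, one_mul]

theorem wig_eq_wigner (ψ χ : L2Config d) : wig ψ χ = wigner ψ χ := by
  ext z
  have h1 : ∫ s : Config d, ψ s * starRingEnd ℂ (symmShiftFun ((2 : ℝ) • z) (parity d χ) s) =
      ∫ s : Config d, ψ s * starRingEnd ℂ (symmShiftFun ((2 : ℝ) • z) (fun t => χ (-t)) s) := by
    refine integral_congr_ae ?_
    filter_upwards [symmShiftFun_congr_ae ((2 : ℝ) • z) (coeFn_parity χ)] with t h
    rw [h]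
  rw [wig, amb_eq_integral, h1, ← integral_add_left_eq_self _ z.fst, wigner]
  -- the substitution `t = 2(s - x)` in the Wigner integral
  have h2 := Measure.integral_comp_smul (volume : Measure (Config d)) (fun s : Config d =>
    ψ (z.fst + s) * starRingEnd ℂ
      (symmShiftFun ((2 : ℝ) • z) (fun t => χ (-t)) (z.fst + s))) (2⁻¹ : ℝ)
  have h3 : |(((2⁻¹ : ℝ) ^ Module.finrank ℝ (Config d))⁻¹)| = (2 : ℝ) ^ d := by
    simp
  rw [h3, Complex.real_smul] at h2
  push_cast at h2
  rw [← h2]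
  refine integral_congr_ae (Filter.Eventually.of_forall fun t => ?_)
  simp only [symmShiftFun, map_mul, conj_cexp_ofReal_mul_I, WithLp.smul_fst, WithLp.smul_snd]
  have e1 : -(z.fst + (2⁻¹ : ℝ) • t - (2 : ℝ) • z.fst) = z.fst - (2⁻¹ : ℝ) • t := by
    rw [two_smul]; abel
  rw [e1, mul_comm (Complex.exp _) (starRingEnd ℂ _), ← mul_assoc]
  congr 2
  rw [← Complex.ofReal_neg]
  congr 2
  simp only [inner_add_right, inner_smul_left, inner_smul_right, real_inner_comm z.snd z.fst]
  norm_num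
  ring

theorem wigner_congr_ae {ψ ψ' χ χ' : Config d → ℂ} (h : ψ =ᵐ[volume] ψ') (h' : χ =ᵐ[volume] χ') :
    wigner ψ χ = wigner ψ' χ' := by
  ext z
  have hq : ∀ c : ℝ, c ≠ 0 →
      Measure.QuasiMeasurePreserving (fun t : Config d => c • t) volume volume := by
    intro c hc
    refine ⟨by fun_prop, ?_⟩
    rw [Measure.map_addHaar_smul volume hc]
    exact Measure.smul_absolutelyContinuous
  have q1 := ((measurePreserving_add_left (volume : Measure (Config d))
    z.fst).quasiMeasurePreserving.comp (hq 2⁻¹ (by norm_num))).ae_eq_comp h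
  have q2 := ((measurePreserving_add_left (volume : Measure (Config d))
    z.fst).quasiMeasurePreserving.comp (hq (-2⁻¹) (by norm_num))).ae_eq_comp h'
  refine integral_congr_ae ?_
  filter_upwards [q1, q2] with t h1 h2
  simp only [Function.comp, neg_smul, ← sub_eq_add_neg] at h1 h2
  rw [h1, h2]

end Heisenberg

section Moyal

variable {d : ℕ}

/-! ### Continuity of the ambiguity function -/

theorem symmShift_eq_modulation_translation (z : PhaseSpace d) (χ : L2Config d) :
    symmShift z χ =
      Complex.exp (((-(Real.pi * inner ℝ z.fst z.snd) : ℝ) : ℂ) * Complex.I) •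
        symmShift (WithLp.toLp 2 (0, z.snd)) (symmShift (WithLp.toLp 2 (z.fst, 0)) χ) := by
  rw [symmShift_symmShift, smul_smul, ← Complex.exp_add, ← add_mul]
  have h1 : (WithLp.toLp 2 (0, z.snd) + WithLp.toLp 2 (z.fst, 0) : PhaseSpace d) = z :=
    WithLp.ofLp_injective 2 (by ext <;> simp)
  have h2 : symplecticForm (WithLp.toLp 2 (0, z.snd)) (WithLp.toLp 2 (z.fst, 0) : PhaseSpace d)
      = inner ℝ z.fst z.snd := by
    simp [symplecticForm, real_inner_comm]
  rw [h1, h2, ← Complex.ofReal_add, neg_add_cancel]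
  simp

theorem continuous_translation (χ : L2Config d) :
    Continuous fun x : Config d => symmShift (WithLp.toLp 2 (x, 0)) χ := by
  let g : Config d → C(Config d, Config d) := fun x => ⟨fun t => t - x, by fun_prop⟩
  have hg : Continuous g := ContinuousMap.continuous_of_continuous_uncurry _ (by
    simp only [g, Function.uncurry_def, ContinuousMap.coe_mk]; fun_prop)
  have hm : ∀ x, MeasurePreserving (g x) volume volume := fun x =>
    measurePreserving_sub_right (volume : Measure (Config d)) x
  have h := Continuous.compMeasurePreservingLp (f := fun _ : Config d => χ) continuous_const hg hm
    (by norm_num)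
  convert h using 2 with x
  refine Lp.ext ?_
  filter_upwards [coeFn_symmShift (WithLp.toLp 2 (x, 0)) χ,
    Lp.coeFn_compMeasurePreserving χ (hm x)] with t h1 h2
  rw [h1, h2]
  simp [symmShiftFun, g]

theorem inner_modulation_eq_fourier (ψ χ : L2Config d) (ω : Config d) :
    inner ℂ (symmShift (WithLp.toLp 2 (0, ω)) χ) ψ =
      𝓕 (fun t => ψ t * starRingEnd ℂ (χ t)) ω := by
  rw [← amb, amb_eq_integral, Real.fourier_eq']
  refine integral_congr_ae (Filter.Eventually.of_forall fun t => ?_)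
  simp only [symmShiftFun, map_mul, conj_cexp_ofReal_mul_I, smul_eq_mul, real_inner_comm ω t]
  change ψ t * (Complex.exp (((-(2 * Real.pi * inner ℝ ω t - Real.pi *
    inner ℝ (0 : Config d) ω) : ℝ) : ℂ) * Complex.I) * starRingEnd ℂ (χ (t - 0))) = _
  rw [show -2 * Real.pi * inner ℝ ω t = -(2 * Real.pi * inner ℝ ω t - Real.pi *
    inner ℝ (0 : Config d) ω) by rw [inner_zero_left]; ring, sub_zero]
  ring

theorem integrable_mul_conj (ψ χ : L2Config d) :
    Integrable fun t => ψ t * starRingEnd ℂ (χ t) := by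
  have := L2.integrable_inner (𝕜 := ℂ) χ ψ
  simpa only [RCLike.inner_apply] using this

theorem continuous_amb (ψ χ : L2Config d) : Continuous (amb ψ χ) := by
  -- up to a continuous phase, `A(ψ, χ)(x, ω)` is `⟨ψ, M_ω T_x χ⟩`
  have key : Continuous fun z : PhaseSpace d =>
      (inner ℂ (symmShift (WithLp.toLp 2 (0, z.snd)) (symmShift (WithLp.toLp 2 (z.fst, 0)) χ)) ψ :
        ℂ) := by
    rw [continuous_iff_continuousAt]
    intro z₀
    set χ₀ := symmShift (WithLp.toLp 2 (z₀.fst, 0)) χ with hχ₀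
    have h1 : Filter.Tendsto (fun z : PhaseSpace d => (inner ℂ (symmShift (WithLp.toLp 2 (0, z.snd))
        (symmShift (WithLp.toLp 2 (z.fst, 0)) χ - χ₀)) ψ : ℂ)) (nhds z₀) (nhds 0) := by
      have hc : Continuous fun z : PhaseSpace d =>
          ‖symmShift (WithLp.toLp 2 (z.fst, 0)) χ - χ₀‖ * ‖ψ‖ :=
        (((continuous_translation χ).comp (WithLp.prod_continuous_ofLp 2 _ _).fst).sub
          continuous_const).norm.mul continuous_const
      refine squeeze_zero_norm (fun z => ?_)
        (by simpa [hχ₀] using hc.tendsto z₀ :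
          Filter.Tendsto _ (nhds z₀) (nhds (0 : ℝ)))
      refine (norm_inner_le_norm _ _).trans ?_
      rw [(symmShift _).norm_map]
    have h2 : Continuous fun z : PhaseSpace d =>
        (inner ℂ (symmShift (WithLp.toLp 2 (0, z.snd)) χ₀) ψ : ℂ) := by
      simp_rw [inner_modulation_eq_fourier]
      exact (continuous_fourier_of_integrable (integrable_mul_conj ψ χ₀)).comp
        (WithLp.prod_continuous_ofLp 2 _ _).snd
    have h3 := h1.add (h2.tendsto z₀)
    rw [zero_add] at h3
    refine h3.congr fun z => ?_
    rw [← inner_add_left, ← map_add, sub_add_cancel]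
  have hph : Continuous fun z : PhaseSpace d =>
      Complex.exp (((Real.pi * inner ℝ z.fst z.snd : ℝ) : ℂ) * Complex.I) := by
    have h1 : Continuous fun z : PhaseSpace d => z.fst := (WithLp.prod_continuous_ofLp 2 _ _).fst
    have h2 : Continuous fun z : PhaseSpace d => z.snd := (WithLp.prod_continuous_ofLp 2 _ _).snd
    fun_prop
  refine (hph.mul key).congr fun z => ?_
  rw [amb, symmShift_eq_modulation_translation z, inner_smul_left, conj_cexp_ofReal_mul_I, neg_neg]
  rfl

/-! ### Moyal's identity -/

theorem eLpNorm_two_sq {α : Type*} [MeasurableSpace α] (μ : Measure α) (f : α → ℂ) :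
    eLpNorm f 2 μ ^ 2 = ∫⁻ x, ‖f x‖ₑ ^ 2 ∂μ := by
  have := eLpNorm_nnreal_pow_eq_lintegral (f := f) (μ := μ) (p := 2) (by norm_num)
  simpa using this

/-- Plancherel in the frequency variable for almost every fixed position, and Tonelli. -/
theorem lintegral_enorm_amb_sq (ψ χ : L2Config d) :
    ∫⁻ z, ‖amb ψ χ z‖ₑ ^ 2 = (∫⁻ t, ‖ψ t‖ₑ ^ 2) * ∫⁻ t, ‖χ t‖ₑ ^ 2 := by
  have hψ : Measurable (ψ : Config d → ℂ) := (Lp.stronglyMeasurable ψ).measurable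
  have hχ : Measurable (χ : Config d → ℂ) := (Lp.stronglyMeasurable χ).measurable
  let h : Config d → Config d → ℂ := fun x t => ψ t * starRingEnd ℂ (χ (t - x))
  have hmeas : Measurable fun p : Config d × Config d => ‖h p.1 p.2‖ₑ ^ 2 := by
    have : Measurable fun p : Config d × Config d => h p.1 p.2 :=
      (hψ.comp measurable_snd).mul (Complex.continuous_conj.measurable.comp
        (hχ.comp (measurable_snd.sub measurable_fst)))
    exact this.enorm.pow_const 2
  have hTon : ∫⁻ x, ∫⁻ t, ‖h x t‖ₑ ^ 2 = (∫⁻ t, ‖ψ t‖ₑ ^ 2) * ∫⁻ t, ‖χ t‖ₑ ^ 2 := by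
    rw [lintegral_lintegral_swap hmeas.aemeasurable,
      ← lintegral_mul_const _ (hψ.enorm.pow_const 2)]
    refine lintegral_congr fun t => ?_
    simp only [h, enorm_mul, mul_pow, RCLike.enorm_conj]
    rw [lintegral_const_mul _ (by fun_prop)]
    congr 1
    exact lintegral_sub_left_eq_self (fun s => ‖χ s‖ₑ ^ 2) t
  have hfin : ∀ f : L2Config d, ∫⁻ t, ‖f t‖ₑ ^ 2 ≠ ⊤ := fun f => by
    rw [← eLpNorm_two_sq]
    exact ENNReal.pow_ne_top (Lp.eLpNorm_ne_top f)
  have hae : ∀ᵐ x, ∫⁻ t, ‖h x t‖ₑ ^ 2 < ⊤ := by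
    refine ae_lt_top hmeas.lintegral_prod_right' ?_
    rw [hTon]
    exact ENNReal.mul_ne_top (hfin ψ) (hfin χ)
  have hslice : ∀ x ω : Config d, ‖amb ψ χ (WithLp.toLp 2 (x, ω))‖ₑ = ‖𝓕 (h x) ω‖ₑ := by
    intro x ω
    rw [amb, symmShift_eq_modulation_translation, inner_smul_left, enorm_mul,
      inner_modulation_eq_fourier, conj_cexp_ofReal_mul_I]
    have e1 : ∀ r : ℝ, ‖Complex.exp ((r : ℂ) * Complex.I)‖ₑ = 1 := fun r => by
      rw [← ofReal_norm, norm_cexp_ofReal_mul_I, ENNReal.ofReal_one]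
    rw [e1, one_mul]
    congr 1
    refine Real.fourier_congr_ae ?_ ω
    filter_upwards [coeFn_symmShift (WithLp.toLp 2 (x, 0)) χ] with t ht
    change ψ t * starRingEnd ℂ (symmShift (WithLp.toLp 2 (x, 0)) χ t) = _
    rw [ht]
    simp [symmShiftFun, h]
  have hint : ∀ x, Integrable (h x) := by
    intro x
    refine (integrable_mul_conj ψ (symmShift (WithLp.toLp 2 (x, 0)) χ)).congr ?_
    filter_upwards [coeFn_symmShift (WithLp.toLp 2 (x, 0)) χ] with t ht
    rw [ht]
    simp [symmShiftFun, h]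
  have hm : Measurable fun z : PhaseSpace d => ‖amb ψ χ z‖ₑ ^ 2 :=
    (continuous_amb ψ χ).measurable.enorm.pow_const 2
  rw [← hTon, ← (WithLp.volume_preserving_toLp (U := Config d) (V := Config d)).lintegral_comp hm,
    Measure.volume_eq_prod, lintegral_prod (fun p => ‖amb ψ χ (WithLp.toLp 2 p)‖ₑ ^ 2)
      (hm.comp (WithLp.measurable_toLp 2 _)).aemeasurable]
  refine lintegral_congr_ae ?_
  filter_upwards [hae] with x hx
  have hL2 : MemLp (h x) 2 := by
    refine ⟨(hint x).1, ?_⟩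
    rw [← eLpNorm_two_sq] at hx
    by_contra hcon
    rw [not_lt, top_le_iff] at hcon
    rw [hcon] at hx
    simp at hx
  simp_rw [hslice]
  rw [← eLpNorm_two_sq, ← eLpNorm_two_sq, eLpNorm_fourier_of_integrable (hint x) hL2]

theorem eLpNorm_amb (ψ χ : L2Config d) :
    eLpNorm (amb ψ χ) 2 volume = eLpNorm ψ 2 volume * eLpNorm χ 2 volume := by
  have h := lintegral_enorm_amb_sq ψ χ
  rw [← eLpNorm_two_sq, ← eLpNorm_two_sq, ← eLpNorm_two_sq, ← mul_pow] at h
  exact (ENNReal.pow_right_strictMono (n := 2) (by norm_num)).injective h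

theorem memLp_amb (ψ χ : L2Config d) : MemLp (amb ψ χ) 2 :=
  ⟨(continuous_amb ψ χ).aestronglyMeasurable, by
    rw [eLpNorm_amb]
    exact ENNReal.mul_lt_top (Lp.eLpNorm_lt_top ψ) (Lp.eLpNorm_lt_top χ)⟩

theorem amb_add_left (ψ ψ' χ : L2Config d) (z : PhaseSpace d) :
    amb (ψ + ψ') χ z = amb ψ χ z + amb ψ' χ z := by simp [amb, inner_add_right]

theorem amb_add_right (ψ χ χ' : L2Config d) (z : PhaseSpace d) :
    amb ψ (χ + χ') z = amb ψ χ z + amb ψ χ' z := by simp [amb, inner_add_left]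

theorem amb_smul_left (c : ℂ) (ψ χ : L2Config d) (z : PhaseSpace d) :
    amb (c • ψ) χ z = c * amb ψ χ z := by simp [amb, inner_smul_right]

theorem amb_smul_right (c : ℂ) (ψ χ : L2Config d) (z : PhaseSpace d) :
    amb ψ (c • χ) z = starRingEnd ℂ c * amb ψ χ z := by simp [amb, inner_smul_left]

theorem norm_amb_le (ψ χ : L2Config d) (z : PhaseSpace d) : ‖amb ψ χ z‖ ≤ ‖ψ‖ * ‖χ‖ := by
  refine (norm_inner_le_norm _ _).trans ?_
  rw [(symmShift z).norm_map, mul_comm]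

/-- The cross-ambiguity function as a bounded sesquilinear map into `L²(ℝ²ᵈ)`, conjugate linear in
the window, which is the first argument here. -/
noncomputable def ambL2 (d : ℕ) : L2Config d →L⋆[ℂ] L2Config d →L[ℂ] L2Phase d :=
  LinearMap.mkContinuous₂
    (LinearMap.mk₂'ₛₗ (starRingEnd ℂ) (RingHom.id ℂ) (fun χ ψ => (memLp_amb ψ χ).toLp (amb ψ χ))
      (fun χ χ' ψ => by
        rw [← MemLp.toLp_add]
        exact MemLp.toLp_congr _ _ (.of_forall fun z => amb_add_right ψ χ χ' z))
      (fun c χ ψ => by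
        rw [← MemLp.toLp_const_smul]
        exact MemLp.toLp_congr _ _ (.of_forall fun z => amb_smul_right c ψ χ z))
      (fun χ ψ ψ' => by
        rw [← MemLp.toLp_add]
        exact MemLp.toLp_congr _ _ (.of_forall fun z => amb_add_left ψ ψ' χ z))
      (fun c χ ψ => by
        rw [RingHom.id_apply, ← MemLp.toLp_const_smul]
        exact MemLp.toLp_congr _ _ (.of_forall fun z => amb_smul_left c ψ χ z)))
    1 fun χ ψ => by
      simp only [LinearMap.mk₂'ₛₗ_apply, Lp.norm_toLp, eLpNorm_amb, ENNReal.toReal_mul,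
        ← Lp.norm_def]
      linarith [mul_comm ‖ψ‖ ‖χ‖]

theorem ambL2_apply (ψ χ : L2Config d) :
    ambL2 d χ ψ = (memLp_amb ψ χ).toLp (amb ψ χ) := rfl

theorem coeFn_ambL2 (ψ χ : L2Config d) : ambL2 d χ ψ =ᵐ[volume] amb ψ χ :=
  (memLp_amb ψ χ).coeFn_toLp

theorem norm_ambL2 (ψ χ : L2Config d) : ‖ambL2 d χ ψ‖ = ‖ψ‖ * ‖χ‖ := by
  rw [ambL2_apply, Lp.norm_toLp, eLpNorm_amb, ENNReal.toReal_mul, ← Lp.norm_def, ← Lp.norm_def]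

/-- Moyal's identity, by polarization of the norm identity in each pair of arguments. -/
theorem inner_ambL2 (ψ ψ' χ χ' : L2Config d) :
    inner ℂ (ambL2 d χ ψ) (ambL2 d χ' ψ') = inner ℂ ψ ψ' * inner ℂ χ' χ := by
  have hdiag : ∀ χ ψ ψ' : L2Config d,
      inner ℂ (ambL2 d χ ψ) (ambL2 d χ ψ') - inner ℂ ψ ψ' * (inner ℂ χ χ : ℂ) = 0 := by
    intro χ
    refine eq_zero_of_diag_eq_zero
      (fun ψ ψ' => inner ℂ (ambL2 d χ ψ) (ambL2 d χ ψ') - inner ℂ ψ ψ' * (inner ℂ χ χ : ℂ))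
      ?_ ?_ ?_ ?_ ?_
    · intro x y z; simp only [map_add, inner_add_left]; ring
    · intro x y z; simp only [map_add, inner_add_right]; ring
    · intro c x y; simp only [map_smul, inner_smul_left]; ring
    · intro c x y; simp only [map_smul, inner_smul_right]; ring
    · intro x
      simp only [inner_self_eq_norm_sq_to_K, norm_ambL2]
      push_cast
      ring
  have h := eq_zero_of_diag_eq_zero
      (fun χ' χ => inner ℂ (ambL2 d χ ψ) (ambL2 d χ' ψ') - inner ℂ ψ ψ' * (inner ℂ χ' χ : ℂ))
      ?_ ?_ ?_ ?_ ?_ χ' χ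
  · exact sub_eq_zero.1 h
  · intro x y z
    simp only [map_add, add_apply, inner_add_left, inner_add_right]; ring
  · intro x y z
    simp only [map_add, add_apply, inner_add_left, inner_add_right]; ring
  · intro c x y
    simp only [map_smulₛₗ, smul_apply, inner_smul_left, inner_smul_right]; ring
  · intro c x y
    simp only [map_smulₛₗ, smul_apply, inner_smul_left, inner_smul_right,
      Complex.conj_conj]; ring
  · intro x
    exact hdiag x ψ ψ'

end Moyal

section WignerL2

variable {d : ℕ}

/-! ### The cross-Wigner distribution on `L²` -/

theorem continuous_wig (ψ χ : L2Config d) : Continuous (wig ψ χ) :=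
  continuous_const.mul ((continuous_amb ψ (parity d χ)).comp (continuous_const_smul (2 : ℝ)))

theorem memLp_wig (ψ χ : L2Config d) : MemLp (wig ψ χ) 2 := by
  have h : Integrable fun z : PhaseSpace d => ‖amb ψ (parity d χ) ((2 : ℝ) • z)‖ ^ 2 :=
    ((memLp_two_iff_integrable_sq_norm (memLp_amb ψ (parity d χ)).1).1
      (memLp_amb ψ (parity d χ))).comp_smul (by norm_num)
  exact MemLp.const_mul ((memLp_two_iff_integrable_sq_norm
    ((continuous_amb ψ (parity d χ)).comp
      (continuous_const_smul (2 : ℝ))).aestronglyMeasurable).2 h) _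

theorem finrank_phaseSpace : Module.finrank ℝ (PhaseSpace d) = d + d := by
  rw [(WithLp.linearEquiv 2 ℝ (Config d × Config d)).finrank_eq, Module.finrank_prod]
  simp

theorem wig_add_left (ψ ψ' χ : L2Config d) (z : PhaseSpace d) :
    wig (ψ + ψ') χ z = wig ψ χ z + wig ψ' χ z := by simp [wig, amb_add_left, mul_add]

theorem wig_add_right (ψ χ χ' : L2Config d) (z : PhaseSpace d) :
    wig ψ (χ + χ') z = wig ψ χ z + wig ψ χ' z := by simp [wig, amb_add_right, mul_add]

theorem wig_smul_left (c : ℂ) (ψ χ : L2Config d) (z : PhaseSpace d) :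
    wig (c • ψ) χ z = c * wig ψ χ z := by simp [wig, amb_smul_left]; ring

theorem wig_smul_right (c : ℂ) (ψ χ : L2Config d) (z : PhaseSpace d) :
    wig ψ (c • χ) z = starRingEnd ℂ c * wig ψ χ z := by simp [wig, amb_smul_right]; ring

theorem conj_wig (ψ χ : L2Config d) (z : PhaseSpace d) :
    starRingEnd ℂ (wig ψ χ z) = wig χ ψ z := by
  rw [wig, wig, amb, amb, map_mul, inner_conj_symm, ← parity_parity (symmShift _ (parity d ψ)),
    parity_symmShift, parity_parity, inner_parity_left, inner_symmShift_left, neg_neg, map_pow,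
    Complex.conj_ofNat]

theorem inner_toLp_wig (ψ ψ' χ χ' : L2Config d) :
    inner ℂ ((memLp_wig ψ χ).toLp (wig ψ χ)) ((memLp_wig ψ' χ').toLp (wig ψ' χ')) =
      inner ℂ ψ ψ' * inner ℂ χ' χ := by
  have h := inner_ambL2 ψ ψ' (parity d χ) (parity d χ')
  rw [(parity d).inner_map_map, L2.inner_def] at h
  rw [L2.inner_def, ← h]
  have h1 : ∫ z, inner ℂ ((memLp_wig ψ χ).toLp (wig ψ χ) z) ((memLp_wig ψ' χ').toLp (wig ψ' χ') z) =
      ∫ z, inner ℂ (wig ψ χ z) (wig ψ' χ' z) := by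
    refine integral_congr_ae ?_
    filter_upwards [(memLp_wig ψ χ).coeFn_toLp, (memLp_wig ψ' χ').coeFn_toLp] with z e1 e2
    rw [e1, e2]
  have h2 : ∫ z, inner ℂ (ambL2 d (parity d χ) ψ z) (ambL2 d (parity d χ') ψ' z) =
      ∫ z, inner ℂ (amb ψ (parity d χ) z) (amb ψ' (parity d χ') z) := by
    refine integral_congr_ae ?_
    filter_upwards [coeFn_ambL2 ψ (parity d χ), coeFn_ambL2 ψ' (parity d χ')] with z e1 e2
    rw [e1, e2]
  have h3 := Measure.integral_comp_smul (volume : Measure (PhaseSpace d))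
    (fun z => (inner ℂ (amb ψ (parity d χ) z) (amb ψ' (parity d χ') z) : ℂ)) 2
  rw [h1, h2]
  have h4 : ∀ z : PhaseSpace d, (inner ℂ (wig ψ χ z) (wig ψ' χ' z) : ℂ) =
      (2 : ℂ) ^ (d + d) *
        inner ℂ (amb ψ (parity d χ) ((2 : ℝ) • z)) (amb ψ' (parity d χ') ((2 : ℝ) • z)) := by
    intro z
    simp only [wig, RCLike.inner_apply, map_mul, map_pow, Complex.conj_ofNat]
    ring
  simp_rw [h4]
  rw [integral_const_mul, h3, finrank_phaseSpace, abs_of_pos (by positivity), Complex.real_smul]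
  push_cast
  rw [← mul_assoc, mul_inv_cancel₀ (pow_ne_zero _ two_ne_zero), one_mul]

theorem norm_toLp_wig (ψ χ : L2Config d) :
    ‖(memLp_wig ψ χ).toLp (wig ψ χ)‖ = ‖ψ‖ * ‖χ‖ := by
  have h := inner_toLp_wig ψ ψ χ χ
  rw [inner_self_eq_norm_sq_to_K, inner_self_eq_norm_sq_to_K, inner_self_eq_norm_sq_to_K] at h
  have h' : ‖(memLp_wig ψ χ).toLp (wig ψ χ)‖ ^ 2 = (‖ψ‖ * ‖χ‖) ^ 2 := by
    rw [mul_pow]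
    exact_mod_cast h
  exact (pow_left_inj₀ (norm_nonneg _) (by positivity) two_ne_zero).1 h'

/-- The cross-Wigner distribution as a bounded sesquilinear map into `L²(ℝ²ᵈ)`, conjugate linear in
the second entry of `W(·, ·)`, which is the first argument here. -/
noncomputable def wigL2 (d : ℕ) : L2Config d →L⋆[ℂ] L2Config d →L[ℂ] L2Phase d :=
  LinearMap.mkContinuous₂
    (LinearMap.mk₂'ₛₗ (starRingEnd ℂ) (RingHom.id ℂ) (fun χ ψ => (memLp_wig ψ χ).toLp (wig ψ χ))
      (fun χ χ' ψ => by
        rw [← MemLp.toLp_add]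
        exact MemLp.toLp_congr _ _ (.of_forall fun z => wig_add_right ψ χ χ' z))
      (fun c χ ψ => by
        rw [← MemLp.toLp_const_smul]
        exact MemLp.toLp_congr _ _ (.of_forall fun z => wig_smul_right c ψ χ z))
      (fun χ ψ ψ' => by
        rw [← MemLp.toLp_add]
        exact MemLp.toLp_congr _ _ (.of_forall fun z => wig_add_left ψ ψ' χ z))
      (fun c χ ψ => by
        rw [RingHom.id_apply, ← MemLp.toLp_const_smul]
        exact MemLp.toLp_congr _ _ (.of_forall fun z => wig_smul_left c ψ χ z)))
    1 fun χ ψ => by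
      simp only [LinearMap.mk₂'ₛₗ_apply, norm_toLp_wig]
      linarith [mul_comm ‖ψ‖ ‖χ‖]

theorem coeFn_wigL2 (ψ χ : L2Config d) : wigL2 d χ ψ =ᵐ[volume] wig ψ χ :=
  (memLp_wig ψ χ).coeFn_toLp

theorem norm_wigL2 (ψ χ : L2Config d) : ‖wigL2 d χ ψ‖ = ‖ψ‖ * ‖χ‖ := norm_toLp_wig ψ χ

/-- Moyal's identity for the cross-Wigner distribution. -/
theorem inner_wigL2 (ψ ψ' χ χ' : L2Config d) :
    inner ℂ (wigL2 d χ ψ) (wigL2 d χ' ψ') = inner ℂ ψ ψ' * inner ℂ χ' χ :=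
  inner_toLp_wig ψ ψ' χ χ'

/-! ### The symplectic Fourier transform -/

/-- The symplectic Fourier transform as a linear isometry of `L²(ℝ²ᵈ)`. -/
noncomputable def symplecticFourierₗᵢ (d : ℕ) : L2Phase d →ₗᵢ[ℂ] L2Phase d :=
  (Lp.compMeasurePreservingₗᵢ ℂ (symplecticJ d) (symplecticJ d).measurePreserving).comp
    (Lp.fourierTransformₗᵢ (PhaseSpace d) ℂ).toLinearIsometry

theorem symplecticFourierₗᵢ_apply (f : L2Phase d) :
    symplecticFourierₗᵢ d f = symplecticFourier f := rfl

theorem symplecticFourierIntegral_eq_fourier (f : PhaseSpace d → ℂ) (z : PhaseSpace d) :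
    symplecticFourierIntegral f z = 𝓕 f (symplecticJ d z) := by
  rw [symplecticFourierIntegral, Real.fourier_eq']
  refine integral_congr_ae (Filter.Eventually.of_forall fun z' => ?_)
  simp only [inner_symplecticJ, smul_eq_mul]
  rw [mul_comm]
  congr 2
  push_cast
  ring

theorem symplecticFourier_ae_eq_integral (f : L2Phase d) (hf : Integrable f) :
    symplecticFourier f =ᵐ[volume] symplecticFourierIntegral f := by
  have h1 := Lp.coeFn_compMeasurePreserving (𝓕 f : L2Phase d) (symplecticJ d).measurePreserving
  have h2 := (symplecticJ d).measurePreserving.quasiMeasurePreserving.ae_eq_comp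
    (fourier_Lp_ae_eq_fourier_integral f hf)
  refine h1.trans (h2.trans (Filter.Eventually.of_forall fun z => ?_))
  exact (symplecticFourierIntegral_eq_fourier f z).symm

theorem symplecticFourierIntegral_congr_ae {f g : PhaseSpace d → ℂ} (h : f =ᵐ[volume] g) :
    symplecticFourierIntegral f = symplecticFourierIntegral g := by
  ext z
  rw [symplecticFourierIntegral_eq_fourier, symplecticFourierIntegral_eq_fourier,
    Real.fourier_congr_ae h]

theorem ae_eq_zero_of_symplecticFourierIntegral_ae_eq_zero {f : PhaseSpace d → ℂ}
    (hf : Integrable f) (hf2 : MemLp f 2) (h : symplecticFourierIntegral f =ᵐ[volume] 0) :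
    f =ᵐ[volume] 0 := by
  refine ae_eq_zero_of_fourier_ae_eq_zero hf hf2 ?_
  have := (symplecticJ d).symm.measurePreserving.quasiMeasurePreserving.ae_eq_comp h
  filter_upwards [this] with z hz
  simpa [symplecticFourierIntegral_eq_fourier] using hz

end WignerL2

section Gaussian

variable {d : ℕ}

/-! ### Covariance under time-frequency shifts -/

theorem inner_symmShift_right (z : PhaseSpace d) (ψ χ : L2Config d) :
    inner ℂ ψ (symmShift z χ) = inner ℂ (symmShift (-z) ψ) χ := by
  rw [inner_symmShift_left, neg_neg]

theorem amb_symmShift (a b z : PhaseSpace d) (ψ χ : L2Config d) :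
    amb (symmShift a ψ) (symmShift b χ) z =
      Complex.exp (((Real.pi * (symplecticForm a b - symplecticForm z (a + b)) : ℝ) : ℂ) *
        Complex.I) * amb ψ χ (z + b - a) := by
  rw [amb, amb, inner_symmShift_right, symmShift_symmShift, symmShift_symmShift,
    smul_smul, ← Complex.exp_add, ← add_mul, ← Complex.ofReal_add, inner_smul_left,
    conj_cexp_ofReal_mul_I, show -a + z + b = z + b - a by abel]
  congr 4
  rw [symplecticForm_add_right, symplecticForm_add_left, symplecticForm_neg_left,
    symplecticForm_neg_left, symplecticForm_swap a z]
  ring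

theorem wig_symmShift (a b z : PhaseSpace d) (ψ χ : L2Config d) :
    wig (symmShift a ψ) (symmShift b χ) z =
      Complex.exp (((-(Real.pi * (symplecticForm a b + 2 * symplecticForm z (a - b))) : ℝ) : ℂ) *
        Complex.I) * wig ψ χ (z - (2⁻¹ : ℝ) • (a + b)) := by
  rw [wig, wig, parity_symmShift, amb_symmShift]
  have h : (2 : ℝ) • (z - (2⁻¹ : ℝ) • (a + b)) = (2 : ℝ) • z + -b - a := by
    rw [smul_sub, smul_smul]; norm_num; abel
  rw [h, mul_left_comm]
  congr 4
  rw [symplecticForm_smul_left, symplecticForm_neg_right, sub_eq_add_neg a b]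
  ring

/-- The symplectic Fourier transform intertwines the covariance of `W` with that of `A`. -/
theorem symplecticFourierIntegral_wig_symmShift (a b ζ : PhaseSpace d) (ψ χ : L2Config d) :
    symplecticFourierIntegral (wig (symmShift a ψ) (symmShift b χ)) ζ =
      Complex.exp (((Real.pi * (symplecticForm a b - symplecticForm ζ (a + b)) : ℝ) : ℂ) *
        Complex.I) * symplecticFourierIntegral (wig ψ χ) (ζ + b - a) := by
  rw [symplecticFourierIntegral, symplecticFourierIntegral,
    ← integral_add_right_eq_self _ ((2⁻¹ : ℝ) • (a + b)), ← integral_const_mul]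
  refine integral_congr_ae (Filter.Eventually.of_forall fun y => ?_)
  simp only [wig_symmShift, add_sub_cancel_right]
  rw [mul_right_comm, ← Complex.exp_add, mul_left_comm, ← Complex.exp_add, mul_comm]
  congr 2
  simp only [symplecticForm_add_left, symplecticForm_add_right, symplecticForm_sub_left,
    symplecticForm_sub_right, symplecticForm_smul_left, symplecticForm_smul_right,
    symplecticForm_self]
  rw [symplecticForm_swap b a, symplecticForm_swap y a, symplecticForm_swap y b]
  push_cast
  ring

/-! ### The Gaussian -/

theorem integrable_cexp_neg_mul_sq_norm {E : Type*} [NormedAddCommGroup E] [InnerProductSpace ℝ E]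
    [FiniteDimensional ℝ E] [MeasurableSpace E] [BorelSpace E] {b : ℝ} (hb : 0 < b) :
    Integrable fun v : E => Complex.exp (-(b : ℂ) * ‖v‖ ^ 2) := by
  simpa using GaussianFourier.integrable_cexp_neg_mul_sq_norm_add (V := E) (b := b)
    (by simpa using hb) 0 0

/-- The Gaussian `e^{-π|t|²}` on `ℝᵈ`. -/
noncomputable def gaussFun (t : Config d) : ℂ := Complex.exp (-(Real.pi : ℂ) * ‖t‖ ^ 2)

theorem continuous_gaussFun : Continuous (gaussFun : Config d → ℂ) := by
  unfold gaussFun; fun_prop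

theorem memLp_gaussFun : MemLp (gaussFun : Config d → ℂ) 2 := by
  rw [memLp_two_iff_integrable_sq_norm continuous_gaussFun.aestronglyMeasurable]
  refine (integrable_cexp_neg_mul_sq_norm (E := Config d) (b := 2 * Real.pi)
    (by positivity)).norm.congr (.of_forall fun t => ?_)
  simp only [gaussFun]
  rw [← norm_pow, ← Complex.exp_nat_mul]
  congr 2
  push_cast
  ring

/-- The Gaussian as an element of `L²(ℝᵈ)`. -/
noncomputable def gauss (d : ℕ) : L2Config d := memLp_gaussFun.toLp gaussFun

theorem coeFn_gauss : gauss d =ᵐ[volume] gaussFun := memLp_gaussFun.coeFn_toLp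

theorem parity_gauss : parity d (gauss d) = gauss d := by
  refine Lp.ext ?_
  filter_upwards [coeFn_parity (gauss d), (Measure.measurePreserving_neg
    (volume : Measure (Config d))).quasiMeasurePreserving.ae_eq_comp coeFn_gauss,
    coeFn_gauss (d := d)] with t h1 h2 h3
  simp only [Function.comp] at h2
  rw [h1, h2, h3]
  simp [gaussFun]

theorem norm_sq_phaseSpace (z : PhaseSpace d) : ‖z‖ ^ 2 = ‖z.fst‖ ^ 2 + ‖z.snd‖ ^ 2 := by
  rw [WithLp.prod_norm_sq_eq_of_L2]

/-- The ambiguity function of the Gaussian, by completing the square. -/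
theorem amb_gauss (z : PhaseSpace d) :
    amb (gauss d) (gauss d) z =
      (1 / 2 : ℂ) ^ (d / 2 : ℂ) * Complex.exp (-(Real.pi / 2 : ℂ) * ‖z‖ ^ 2) := by
  have h1 : ∫ t : Config d, gauss d t * starRingEnd ℂ (symmShiftFun z (gauss d) t) =
      ∫ t : Config d, gaussFun t * starRingEnd ℂ (symmShiftFun z gaussFun t) := by
    refine integral_congr_ae ?_
    filter_upwards [symmShiftFun_congr_ae z (coeFn_gauss (d := d)), coeFn_gauss (d := d)]
      with t h h'
    rw [h, h']
  have h2 := fourier_gaussian_innerProductSpace (V := Config d) (b := 2 * Real.pi)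
    (by simp [Real.pi_pos]) z.snd
  have hpi : (Real.pi : ℂ) ≠ 0 := Complex.ofReal_ne_zero.2 Real.pi_ne_zero
  rw [show (Real.pi : ℂ) / (2 * Real.pi) = 1 / 2 by field_simp,
    finrank_euclideanSpace_fin] at h2
  have h3 : (1 / 2 : ℂ) ^ (d / 2 : ℂ) * Complex.exp (-(Real.pi / 2 : ℂ) * ‖z‖ ^ 2) =
      Complex.exp (-(Real.pi / 2 : ℂ) * ‖z.fst‖ ^ 2) *
        𝓕 (fun v : Config d => Complex.exp (-(2 * Real.pi : ℂ) * ‖v‖ ^ 2)) z.snd := by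
    rw [h2, mul_left_comm, ← Complex.exp_add]
    congr 2
    rw [← Complex.ofReal_pow, norm_sq_phaseSpace]
    push_cast
    field_simp
    ring
  rw [amb_eq_integral, h1, ← integral_add_right_eq_self _ ((2⁻¹ : ℝ) • z.fst), h3,
    Real.fourier_eq', ← integral_const_mul]
  refine integral_congr_ae (Filter.Eventually.of_forall fun t => ?_)
  simp only [symmShiftFun, map_mul, conj_cexp_ofReal_mul_I, gaussFun, smul_eq_mul]
  have e1 : t + (2⁻¹ : ℝ) • z.fst - z.fst = t - (2⁻¹ : ℝ) • z.fst := by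
    module
  rw [e1, ← Complex.exp_conj, ← Complex.exp_add, ← Complex.exp_add, ← Complex.exp_add,
    ← Complex.exp_add]
  congr 1
  have e2 : ‖t + (2⁻¹ : ℝ) • z.fst‖ ^ 2 + ‖t - (2⁻¹ : ℝ) • z.fst‖ ^ 2 =
      2 * ‖t‖ ^ 2 + ‖z.fst‖ ^ 2 / 2 := by
    have := parallelogram_law_with_norm ℝ t ((2⁻¹ : ℝ) • z.fst)
    rw [norm_smul] at this
    norm_num at this
    nlinarith
  have e3 : ((‖t + (2⁻¹ : ℝ) • z.fst‖ : ℂ)) ^ 2 + (‖t - (2⁻¹ : ℝ) • z.fst‖ : ℂ) ^ 2 =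
      2 * (‖t‖ : ℂ) ^ 2 + (‖z.fst‖ : ℂ) ^ 2 / 2 := by exact_mod_cast e2
  simp only [map_mul, map_neg, map_pow, Complex.conj_ofReal, inner_add_right, inner_smul_right,
    real_inner_comm z.snd]
  push_cast
  linear_combination (-(Real.pi : ℂ)) * e3

theorem wig_gauss (z : PhaseSpace d) :
    wig (gauss d) (gauss d) z = (2 : ℂ) ^ d * (1 / 2 : ℂ) ^ (d / 2 : ℂ) *
      Complex.exp (-((2 * Real.pi : ℝ) : ℂ) * ‖z‖ ^ 2) := by
  rw [wig, parity_gauss, amb_gauss, ← mul_assoc, norm_smul]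
  congr 2
  push_cast
  norm_num
  ring

theorem wig_gauss_ne_zero (z : PhaseSpace d) : wig (gauss d) (gauss d) z ≠ 0 := by
  rw [wig_gauss]
  have : (1 / 2 : ℂ) ^ (d / 2 : ℂ) ≠ 0 := by
    rw [Complex.cpow_def_of_ne_zero (by norm_num)]; exact Complex.exp_ne_zero _
  exact mul_ne_zero (mul_ne_zero (pow_ne_zero _ two_ne_zero) this) (Complex.exp_ne_zero _)

theorem integrable_wig_gauss : Integrable (wig (gauss d) (gauss d)) := by
  rw [funext wig_gauss]
  exact (integrable_cexp_neg_mul_sq_norm (by positivity)).const_mul _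

theorem gauss_ne_zero : gauss d ≠ 0 := fun h => wig_gauss_ne_zero (d := d) 0 (by
  rw [h]; simp [wig, amb])

theorem symplecticFourierIntegral_wig_gauss (ζ : PhaseSpace d) :
    symplecticFourierIntegral (wig (gauss d) (gauss d)) ζ = amb (gauss d) (gauss d) ζ := by
  have h2 := fourier_gaussian_innerProductSpace (V := PhaseSpace d) (b := (2 * Real.pi : ℝ))
    (by simp [Real.pi_pos]) (symplecticJ d ζ)
  have hpi : (Real.pi : ℂ) ≠ 0 := Complex.ofReal_ne_zero.2 Real.pi_ne_zero
  rw [show (Real.pi : ℂ) / ((2 * Real.pi : ℝ) : ℂ) = 1 / 2 by push_cast; field_simp,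
    finrank_phaseSpace, (symplecticJ d).norm_map,
    show (((d + d : ℕ) : ℂ) / 2) = (d : ℂ) by push_cast; ring, Complex.cpow_natCast,
    Real.fourier_eq'] at h2
  rw [symplecticFourierIntegral_eq_fourier, Real.fourier_eq', amb_gauss]
  simp only [wig_gauss, smul_eq_mul] at h2 ⊢
  simp_rw [mul_left_comm _ ((2 : ℂ) ^ d * (1 / 2 : ℂ) ^ (d / 2 : ℂ)) _]
  rw [integral_const_mul, h2, mul_mul_mul_comm, ← mul_pow]
  have e : -(Real.pi : ℂ) ^ 2 * (‖ζ‖ : ℂ) ^ 2 / ((2 * Real.pi : ℝ) : ℂ) =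
      -(Real.pi / 2 : ℂ) * ‖ζ‖ ^ 2 := by
    push_cast; field_simp
  rw [e]
  norm_num

/-- The time-frequency shifts of the Gaussian are total in `L²(ℝᵈ)`: a function orthogonal to all
of them has vanishing ambiguity function with the Gaussian, hence is zero by Moyal's identity. -/
theorem dense_span_symmShift_gauss :
    Dense (Submodule.span ℂ (Set.range fun a : PhaseSpace d => symmShift a (gauss d)) :
      Set (L2Config d)) := by
  rw [Submodule.dense_iff_topologicalClosure_eq_top, Submodule.topologicalClosure_eq_top_iff,
    Submodule.eq_bot_iff]
  intro ψ hψ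
  rw [Submodule.mem_orthogonal] at hψ
  have h0 : ambL2 d (gauss d) ψ = 0 := by
    refine Lp.ext ?_
    filter_upwards [coeFn_ambL2 ψ (gauss d), Lp.coeFn_zero ℂ 2 (volume : Measure (PhaseSpace d))]
      with z h1 h2
    rw [h1, h2]
    exact hψ _ (Submodule.subset_span ⟨z, rfl⟩)
  have h1 := norm_ambL2 ψ (gauss d)
  rw [h0, norm_zero, zero_eq_mul, norm_eq_zero, norm_eq_zero] at h1
  exact h1.resolve_right gauss_ne_zero

/-- `F_σ W(ψ, χ) = A(ψ, χ)`. By sesquilinearity and density it suffices to treat time-frequency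
shifts of the Gaussian. -/
theorem symplecticFourier_wigL2 (ψ χ : L2Config d) :
    symplecticFourier (wigL2 d χ ψ) = ambL2 d χ ψ := by
  have hgauss : ∀ a b : PhaseSpace d,
      symplecticFourier (wigL2 d (symmShift b (gauss d)) (symmShift a (gauss d))) =
        ambL2 d (symmShift b (gauss d)) (symmShift a (gauss d)) := by
    intro a b
    have hc := coeFn_wigL2 (symmShift a (gauss d)) (symmShift b (gauss d))
    have hint : Integrable (wig (symmShift a (gauss d)) (symmShift b (gauss d))) := by
      refine (integrable_wig_gauss.comp_sub_right ((2⁻¹ : ℝ) • (a + b))).congr'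
        (continuous_wig _ _).aestronglyMeasurable (.of_forall fun z => ?_)
      rw [wig_symmShift, norm_mul, norm_cexp_ofReal_mul_I, one_mul]
    refine Lp.ext ((symplecticFourier_ae_eq_integral _ (hint.congr hc.symm)).trans ?_)
    rw [symplecticFourierIntegral_congr_ae hc]
    filter_upwards [coeFn_ambL2 (symmShift a (gauss d)) (symmShift b (gauss d))] with ζ h
    rw [h, symplecticFourierIntegral_wig_symmShift, amb_symmShift,
      symplecticFourierIntegral_wig_gauss]
  have hleft : ∀ (b : PhaseSpace d) (ψ : L2Config d),
      symplecticFourier (wigL2 d (symmShift b (gauss d)) ψ) =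
        ambL2 d (symmShift b (gauss d)) ψ := by
    intro b ψ
    have h := ContinuousLinearMap.ext_on (dense_span_symmShift_gauss (d := d))
      (f := (symplecticFourierₗᵢ d).toContinuousLinearMap.comp
        (wigL2 d (symmShift b (gauss d)))) (g := ambL2 d (symmShift b (gauss d))) (by
          rintro _ ⟨a, rfl⟩
          exact hgauss a b)
    exact DFunLike.congr_fun h ψ
  have h := ContinuousLinearMap.ext_on (dense_span_symmShift_gauss (d := d))
    (f := (symplecticFourierₗᵢ d).toContinuousLinearMap.comp ((wigL2 d).flip ψ))
    (g := (ambL2 d).flip ψ) (by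
      rintro _ ⟨b, rfl⟩
      exact hleft b ψ)
  exact DFunLike.congr_fun h χ

end Gaussian

section PhaseRetrieval

variable {d : ℕ}

/-! ### Recovering a function from its ambiguity function -/

theorem exists_phase_of_amb_self_eq {ψ₁ ψ₂ : L2Config d} (h : amb ψ₁ ψ₁ = amb ψ₂ ψ₂) :
    ∃ α : ℝ, ψ₁ = Complex.exp (Complex.I * α) • ψ₂ := by
  refine exists_phase_of_inner_mul_inner_eq ψ₁ ψ₂ fun η χ => ?_
  have h' : ambL2 d ψ₁ ψ₁ = ambL2 d ψ₂ ψ₂ := by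
    rw [ambL2_apply, ambL2_apply]
    exact MemLp.toLp_congr _ _ (.of_forall fun z => congrFun h z)
  rw [← inner_ambL2, ← inner_ambL2, h']

theorem conj_amb (ψ χ : L2Config d) (z : PhaseSpace d) :
    starRingEnd ℂ (amb ψ χ z) = amb χ ψ (-z) := by
  rw [amb, amb, inner_conj_symm, inner_symmShift_right]

theorem inner_Lp_eq_integral {α : Type*} [MeasurableSpace α] {μ : Measure α} (f g : Lp ℂ 2 μ)
    {f' g' : α → ℂ} (hf : f =ᵐ[μ] f') (hg : g =ᵐ[μ] g') :
    inner ℂ f g = ∫ x, starRingEnd ℂ (f' x) * g' x ∂μ := by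
  rw [L2.inner_def]
  refine integral_congr_ae ?_
  filter_upwards [hf, hg] with x h1 h2
  rw [h1, h2, RCLike.inner_apply, mul_comm]

/-- The symplectic Fourier transform of the spectrogram `|A(ψ, φ)|²` is the product of `A(ψ, ψ)`
and the conjugate of `A(φ, φ)`, evaluated here at `-w`: by covariance, modulating `A(ψ, φ)`
amounts to shifting both entries by the same `w`, so this is an instance of Moyal's identity. -/
theorem integral_norm_sq_amb_mul_cexp (ψ φ : L2Config d) (w : PhaseSpace d) :
    ∫ z, Complex.exp (((-(Real.pi * symplecticForm z (w + w)) : ℝ) : ℂ) * Complex.I) *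
        ((‖amb ψ φ z‖ ^ 2 : ℝ) : ℂ) = starRingEnd ℂ (amb ψ ψ w) * amb φ φ w := by
  have h := inner_ambL2 ψ (symmShift w ψ) φ (symmShift w φ)
  rw [inner_Lp_eq_integral _ _ (coeFn_ambL2 _ _) (coeFn_ambL2 _ _)] at h
  have e : (inner ℂ ψ (symmShift w ψ) : ℂ) = starRingEnd ℂ (amb ψ ψ w) := by
    rw [amb, inner_conj_symm]
  rw [e] at h
  rw [amb.eq_1 φ φ w, ← h]
  refine integral_congr_ae (.of_forall fun z => ?_)
  simp only [amb_symmShift, symplecticForm_self, add_sub_cancel_right]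
  rw [mul_left_comm, ← Complex.normSq_eq_conj_mul_self, Complex.normSq_eq_norm_sq]
  congr 3
  push_cast
  ring

theorem amb_self_eq_of_norm_amb_eq {φ ψ₁ ψ₂ : L2Config d}
    (hφ : Dense {z : PhaseSpace d | amb φ φ z = 0}ᶜ)
    (h : ∀ z, ‖amb ψ₁ φ z‖ = ‖amb ψ₂ φ z‖) : amb ψ₁ ψ₁ = amb ψ₂ ψ₂ := by
  refine Continuous.ext_on hφ (continuous_amb _ _) (continuous_amb _ _) fun w hw => ?_
  have h1 := integral_norm_sq_amb_mul_cexp ψ₁ φ w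
  simp_rw [h] at h1
  rw [integral_norm_sq_amb_mul_cexp ψ₂ φ w] at h1
  exact (star_injective (mul_right_cancel₀ hw h1)).symm

/-! ### Cohen's class distributions -/

theorem amb_parity (ψ χ : L2Config d) (z : PhaseSpace d) :
    amb (parity d ψ) (parity d χ) z = amb ψ χ (-z) := by
  rw [amb, amb, ← (parity d).inner_map_map (symmShift (-z) χ), parity_symmShift, neg_neg]

theorem wig_parity (ψ χ : L2Config d) (z : PhaseSpace d) :
    wig (parity d ψ) (parity d χ) z = wig ψ χ (-z) := by
  rw [wig, wig, amb_parity, smul_neg]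

theorem wig_reflect (ψ : L2Config d) (z y : PhaseSpace d) :
    wig (parity d (symmShift (-z) ψ)) (parity d (symmShift (-z) ψ)) y = wig ψ ψ (z - y) := by
  have h : -y - (2⁻¹ : ℝ) • (-z + -z) = z - y := by module
  rw [wig_parity, wig_symmShift, h, symplecticForm_self, sub_self, ← zero_smul ℝ z,
    symplecticForm_smul_right]
  simp

theorem conj_amb_reflect (ψ : L2Config d) (z ζ : PhaseSpace d) :
    starRingEnd ℂ (amb (parity d (symmShift (-z) ψ)) (parity d (symmShift (-z) ψ)) ζ) =
      amb ψ ψ ζ * Complex.exp (-(2 * Real.pi * symplecticForm z ζ : ℝ) * Complex.I) := by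
  rw [amb_parity, amb_symmShift, map_mul, conj_cexp_ofReal_mul_I, conj_amb, mul_comm,
    symplecticForm_self, symplecticForm_add_right, symplecticForm_neg_left,
    symplecticForm_neg_right, symplecticForm_swap ζ z, ← Complex.ofReal_neg]
  congr 4
  · abel
  · ring

/-- The symplectic Fourier transform turns the convolution `W(ψ, ψ) ∗ φ` into the product of
`A(ψ, ψ)` and `F_σ φ`. -/
theorem cohen_eq_symplecticFourierIntegral (φ : L2Phase d) (ψ : L2Config d) (z : PhaseSpace d) :
    cohen φ ψ z = symplecticFourierIntegral (fun ζ => amb ψ ψ ζ * symplecticFourier φ ζ) z := by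
  -- `y ↦ W(ψ, ψ)(z - y)` is the Wigner distribution of the reflection `ψ'` of `ψ`
  set ψ' := parity d (symmShift (-z) ψ) with hψ'
  have h1 : cohen φ ψ z = ∫ y, starRingEnd ℂ (wig ψ' ψ' y) * φ y := by
    have : (volume : Measure (PhaseSpace d)).IsNegInvariant :=
      ⟨(LinearIsometryEquiv.neg ℝ).measurePreserving.map_eq⟩
    rw [cohen, convolution_def, ← wig_eq_wigner, 
      ← integral_sub_left_eq_self _ (volume : Measure (PhaseSpace d)) z]
    refine integral_congr_ae (.of_forall fun y => ?_)
    simp only [ContinuousLinearMap.mul_apply', sub_sub_cancel, conj_wig]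
    rw [hψ', wig_reflect]
  rw [h1, ← inner_Lp_eq_integral _ _ (coeFn_wigL2 ψ' ψ') (ae_eq_refl (φ : PhaseSpace d → ℂ)),
    ← (symplecticFourierₗᵢ d).inner_map_map, symplecticFourierₗᵢ_apply,
    symplecticFourierₗᵢ_apply, symplecticFourier_wigL2,
    inner_Lp_eq_integral _ _ (coeFn_ambL2 ψ' ψ') (ae_eq_refl _), symplecticFourierIntegral]
  refine integral_congr_ae (.of_forall fun ζ => ?_)
  simp only [hψ', conj_amb_reflect]
  ring

theorem memLp_amb_mul (ψ χ : L2Config d) (f : L2Phase d) :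
    MemLp (fun ζ => amb ψ χ ζ * f ζ) 2 :=
  (Lp.memLp f).of_le_mul ((continuous_amb ψ χ).aestronglyMeasurable.mul (Lp.memLp f).1)
    (.of_forall fun ζ => by
      rw [norm_mul]
      exact mul_le_mul_of_nonneg_right (norm_amb_le ψ χ ζ) (norm_nonneg _))

theorem integrable_amb_mul (ψ χ : L2Config d) (f : L2Phase d) :
    Integrable (fun ζ => amb ψ χ ζ * f ζ) :=
  (memLp_amb ψ χ).integrable_mul (Lp.memLp f)

theorem amb_self_eq_of_cohen_ae_eq {φ : L2Phase d} {g : PhaseSpace d → ℂ} (hg : Continuous g)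
    (hφg : symplecticFourier φ =ᵐ[volume] g) (hd : Dense {z | g z = 0}ᶜ) {ψ₁ ψ₂ : L2Config d}
    (h : cohen φ ψ₁ =ᵐ[volume] cohen φ ψ₂) : amb ψ₁ ψ₁ = amb ψ₂ ψ₂ := by
  have i1 := integrable_amb_mul ψ₁ ψ₁ (symplecticFourier φ)
  have i2 := integrable_amb_mul ψ₂ ψ₂ (symplecticFourier φ)
  have h0 := ae_eq_zero_of_symplecticFourierIntegral_ae_eq_zero (i1.sub i2)
    ((memLp_amb_mul ψ₁ ψ₁ (symplecticFourier φ)).sub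
      (memLp_amb_mul ψ₂ ψ₂ (symplecticFourier φ))) (by
    filter_upwards [h] with z hz
    rw [cohen_eq_symplecticFourierIntegral, cohen_eq_symplecticFourierIntegral,
      symplecticFourierIntegral_eq_fourier, symplecticFourierIntegral_eq_fourier] at hz
    rw [symplecticFourierIntegral_eq_fourier, Real.fourier_eq]
    rw [Real.fourier_eq, Real.fourier_eq] at hz
    simp only [Pi.sub_apply, smul_sub]
    rw [integral_sub ((Real.fourierIntegral_convergent_iff _).2 i1)
      ((Real.fourierIntegral_convergent_iff _).2 i2), hz, sub_self]
    rfl)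
  have h1 : (fun z => amb ψ₁ ψ₁ z * g z) = fun z => amb ψ₂ ψ₂ z * g z := by
    refine (Continuous.ae_eq_iff_eq (volume : Measure (PhaseSpace d))
      ((continuous_amb _ _).mul hg) ((continuous_amb _ _).mul hg)).1 ?_
    filter_upwards [h0, hφg] with z hz hz'
    change amb ψ₁ ψ₁ z * g z = amb ψ₂ ψ₂ z * g z
    rw [← hz', ← sub_eq_zero]
    exact hz
  exact Continuous.ext_on hd (continuous_amb _ _) (continuous_amb _ _) fun w hw =>
    mul_right_cancel₀ hw (congrFun h1 w)

/-! ### The Weyl symbol of a trace class operator -/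

/-- The cross-Wigner distributions are total in `L²(ℝ²ᵈ)`: those of shifted Gaussians already
include all modulations of a nowhere vanishing Gaussian. -/
theorem eq_zero_of_inner_wigL2_eq_zero {f : L2Phase d}
    (h : ∀ ψ χ : L2Config d, inner ℂ (wigL2 d χ ψ) f = 0) : f = 0 := by
  set G : PhaseSpace d → ℂ := fun z => wig (gauss d) (gauss d) z * f z with hG
  have hbd : ∀ z, ‖wig (gauss d) (gauss d) z‖ ≤ 2 ^ d * (‖gauss d‖ * ‖gauss d‖) := fun z => by
    rw [wig, norm_mul, norm_pow, Complex.norm_ofNat, parity_gauss]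
    exact mul_le_mul_of_nonneg_left (norm_amb_le _ _ _) (by positivity)
  have hG1 : Integrable G := (memLp_wig _ _).integrable_mul (Lp.memLp f)
  have hG2 : MemLp G 2 :=
    (Lp.memLp f).of_le_mul ((continuous_wig _ _).aestronglyMeasurable.mul (Lp.memLp f).1)
      (.of_forall fun z => by
        rw [norm_mul]
        exact mul_le_mul_of_nonneg_right (hbd z) (norm_nonneg _))
  have hF : symplecticFourierIntegral G = 0 := by
    ext w
    have h1 := h (symmShift ((2⁻¹ : ℝ) • w) (gauss d)) (symmShift (-((2⁻¹ : ℝ) • w)) (gauss d))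
    rw [inner_Lp_eq_integral _ _ (coeFn_wigL2 _ _) (ae_eq_refl (f : PhaseSpace d → ℂ))] at h1
    rw [Pi.zero_apply, ← h1, symplecticFourierIntegral]
    refine integral_congr_ae (.of_forall fun z => ?_)
    have e : (2⁻¹ : ℝ) • w - -((2⁻¹ : ℝ) • w) = w := by module
    simp only [hG]
    rw [wig_symmShift, map_mul, conj_cexp_ofReal_mul_I, conj_wig, e, add_neg_cancel, smul_zero,
      sub_zero, symplecticForm_neg_right, symplecticForm_self, symplecticForm_swap z w,
      mul_comm, ← mul_assoc, ← Complex.ofReal_neg]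
    congr 4
    push_cast
    ring
  have h0 := ae_eq_zero_of_symplecticFourierIntegral_ae_eq_zero hG1 hG2
    (Filter.EventuallyEq.of_eq hF)
  refine (Lp.eq_zero_iff_ae_eq_zero).2 ?_
  filter_upwards [h0] with z hz
  exact (mul_eq_zero.1 hz).resolve_left (wig_gauss_ne_zero z)

/-- The defining relation of the Weyl transform extends from Schwartz functions to all of
`L²(ℝᵈ)`. -/
theorem inner_wigL2_of_isWeylTransform {φ : L2Phase d} {L : L2Config d →L[ℂ] L2Config d}
    (hL : IsWeylTransform φ L) (χ ψ : L2Config d) :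
    inner ℂ (wigL2 d ψ χ) φ = inner ℂ χ (L ψ) := by
  have hdense : DenseRange fun f : 𝓢(Config d, ℂ) => (f.toLp 2 volume : L2Config d) :=
    SchwartzMap.denseRange_toLpCLM (F := ℂ) (E := Config d) (p := 2) (by norm_num)
  refine hdense.induction_on₂
    (p := fun χ ψ : L2Config d => inner ℂ (wigL2 d ψ χ) φ = inner ℂ χ (L ψ)) ?_ ?_ χ ψ
  · refine isClosed_eq ?_ ?_
    · have : Continuous fun q : L2Config d × L2Config d => wigL2 d q.2 q.1 := by fun_prop
      exact this.inner continuous_const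
    · exact continuous_fst.inner (L.continuous.comp continuous_snd)
  · intro χ ψ
    rw [hL ψ χ, inner_Lp_eq_integral _ _ (coeFn_wigL2 _ _) (ae_eq_refl (φ : PhaseSpace d → ℂ))]
    refine integral_congr_ae (.of_forall fun z => ?_)
    dsimp only
    rw [conj_wig, wig_eq_wigner, wigner_congr_ae (ψ.coeFn_toLp 2 volume) (χ.coeFn_toLp 2 volume),
      mul_comm]

/-- If `L_φ = ∑ sₙ uₙ ⊗ vₙ` is trace class, then `φ = ∑ sₙ W(uₙ, vₙ)`, and `F_σ φ` is
represented by the uniformly convergent series `∑ sₙ A(uₙ, vₙ)`. -/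
theorem exists_continuous_symplecticFourier {φ : L2Phase d} {L : L2Config d →L[ℂ] L2Config d}
    (hL : IsWeylTransform φ L) (htr : IsTraceClass L) :
    ∃ g : PhaseSpace d → ℂ, Continuous g ∧ symplecticFourier φ =ᵐ[volume] g := by
  obtain ⟨ι, s, u, v, hu, hv, hs, hsum, hLs⟩ := htr
  have hcount : Countable ι := by
    have := hsum.countable_support
    have huniv : Function.support s = Set.univ := by
      ext n; simp [(hs n).ne']
    rw [huniv] at this
    exact Set.countable_univ_iff.1 this
  have hnw : ∀ n, ‖(s n : ℂ) • wigL2 d (v n) (u n)‖ = s n := fun n => by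
    rw [norm_smul, norm_wigL2, hu.1 n, hv.1 n, Complex.norm_real, Real.norm_of_nonneg (hs n).le]
    ring
  have hna : ∀ n, ‖(s n : ℂ) • ambL2 d (v n) (u n)‖ = s n := fun n => by
    rw [norm_smul, norm_ambL2, hu.1 n, hv.1 n, Complex.norm_real, Real.norm_of_nonneg (hs n).le]
    ring
  have hsw : Summable fun n => (s n : ℂ) • wigL2 d (v n) (u n) :=
    Summable.of_norm (by simpa only [hnw] using hsum)
  have hφ : φ = ∑' n, (s n : ℂ) • wigL2 d (v n) (u n) := by
    rw [← sub_eq_zero]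
    refine eq_zero_of_inner_wigL2_eq_zero fun χ ψ => ?_
    rw [inner_sub_right, inner_wigL2_of_isWeylTransform hL, sub_eq_zero]
    have h1 : HasSum (fun n => (s n : ℂ) * (inner ℂ χ (u n) * inner ℂ (v n) ψ))
        (inner ℂ (wigL2 d ψ χ) (∑' n, (s n : ℂ) • wigL2 d (v n) (u n))) := by
      have := hsw.hasSum.mapL (innerSL ℂ (wigL2 d ψ χ))
      simpa only [innerSL_apply_apply, inner_smul_right, inner_wigL2] using this
    have h2 : HasSum (fun n => (s n : ℂ) * (inner ℂ χ (u n) * inner ℂ (v n) ψ))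
        (inner ℂ χ (L ψ)) := by
      have := (hLs.mapL (ContinuousLinearMap.apply ℂ (L2Config d) ψ)).mapL (innerSL ℂ χ)
      simpa [inner_smul_right, mul_comm, mul_left_comm] using this
    exact h2.unique h1
  have hF : symplecticFourier φ = ∑' n, (s n : ℂ) • ambL2 d (v n) (u n) := by
    have := (hsw.hasSum.mapL (symplecticFourierₗᵢ d).toContinuousLinearMap).tsum_eq
    rw [hφ]
    refine this.symm.trans (tsum_congr fun n => ?_)
    rw [map_smul]
    exact congrArg _ (symplecticFourier_wigL2 _ _)
  refine ⟨fun z => ∑' n, (s n : ℂ) * amb (u n) (v n) z, ?_, ?_⟩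
  · refine continuous_tsum (fun n => continuous_const.mul (continuous_amb _ _)) hsum fun n z => ?_
    rw [norm_mul, Complex.norm_real, Real.norm_of_nonneg (hs n).le]
    have := norm_amb_le (u n) (v n) z
    rw [hu.1 n, hv.1 n, one_mul] at this
    exact mul_le_of_le_one_right (hs n).le this
  · have hfin : ∑' n, ‖(s n : ℂ) • ambL2 d (v n) (u n)‖ₑ ≠ ⊤ := by
      simp_rw [← ofReal_norm, hna]
      exact hsum.tsum_ofReal_ne_top
    have hae : ∀ᵐ z, ∀ n, ((s n : ℂ) • ambL2 d (v n) (u n) : L2Phase d) z =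
        (s n : ℂ) * amb (u n) (v n) z := ae_all_iff.2 fun n => by
      filter_upwards [Lp.coeFn_smul (s n : ℂ) (ambL2 d (v n) (u n)), coeFn_ambL2 (u n) (v n)]
        with z e1 e2
      rw [e1, Pi.smul_apply, e2, smul_eq_mul]
    rw [hF]
    filter_upwards [Lp.hasSum_coeFn_tsum hfin, hae] with z h1 h2
    simp_rw [h2] at h1
    exact h1.tsum_eq.symm

end PhaseRetrieval

theorem mainTheorem10 (d : ℕ) :
    (∀ (φ : L2Phase d) (L : L2Config d →L[ℂ] L2Config d),
      IsWeylTransform φ L → IsTraceClass L →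
        ∃ g : PhaseSpace d → ℂ, Continuous g ∧ symplecticFourier φ =ᵐ[volume] g ∧
          (Dense {z | g z = 0}ᶜ →
            ∀ ψ₁ ψ₂ : L2Config d, cohen φ ψ₁ =ᵐ[volume] cohen φ ψ₂ →
              ∃ α : ℝ, ψ₁ = Complex.exp (Complex.I * α) • ψ₂)) ∧
    (∀ φ : L2Config d, Dense {z : PhaseSpace d | ambiguity φ φ z = 0}ᶜ →
      ∀ ψ₁ ψ₂ : L2Config d, (∀ z : PhaseSpace d, ‖stft φ ψ₁ z‖ = ‖stft φ ψ₂ z‖) →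
        ∃ α : ℝ, ψ₁ = Complex.exp (Complex.I * α) • ψ₂) := by
  refine ⟨fun φ L hL htr => ?_, fun φ hφ ψ₁ ψ₂ h => ?_⟩
  · obtain ⟨g, hg, hφg⟩ := exists_continuous_symplecticFourier hL htr
    exact ⟨g, hg, hφg, fun hd ψ₁ ψ₂ h =>
      exists_phase_of_amb_self_eq (amb_self_eq_of_cohen_ae_eq hg hφg hd h)⟩
  · simp_rw [← amb_eq_ambiguity] at hφ
    simp_rw [norm_stft] at h
    exact exists_phase_of_amb_self_eq (amb_self_eq_of_norm_amb_eq hφ h)
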